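/- **Theorem 2 (Probability Density Function).** For $i=1,2$ let $I_i$ be independent random variables with the mixture Exponential–Generalized Gamma densities $$f_{I_i}(x)=\frac{\omega_i}{\lambda_i}e^{-x/\lambda_i}+(1-\omega_i)\frac{c_i\,x^{a_ic_i-1}}{b_i^{a_ic_i}\Gamma(a_i)}e^{-(x/b_i)^{c_i}},\qquad x>0,$$ where $0<\omega_i<1$ and $\lambda_i,a_i,b_i,c_i>0$. Let $r_i\in\{1,2\}$, $\eta,N_{0_i},C>0$, let $\gamma_i=(\eta I_i)^{r_i}/N_{0_i}$ be the SNR of the $i$-th hop, let $\mu_{r_i}=\eta^{r_i}/N_{0_i}$ be its average electrical SNR, and let $\gamma=\gamma_1\gamma_2/(\gamma_2+C)$ be the end-to-end SNR. Then $\mu_{r_i}=\mathbb E[\gamma_i]$ if $r_i=1$ and $\mathbb E[I_i]=1$, and $\mu_{r_i}=\mathbb E[\gamma_i]/\big(2\omega_i\lambda_i^2+b_i^2(1-\omega_i)\Gamma(a_i+2/c_i)/\Gamma(a_i)\big)$ if $r_i=2$. Write, for $x,y>0$ and $\alpha,\beta,A,B>0$, $$\mathcal H_{\alpha,A;\beta,B}(x,y)=\mathrm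 H^{0,1:0,1:2,0}_{1,0:1,1:0,2}\left[\begin{matrix}(1;1,1)\\ -\end{matrix}\middle|\begin{matrix}(1-\alpha,A)\\(1,1)\end{matrix}\middle|\begin{matrix}-\\(0,1)(\beta,B)\end{matrix}\middle|\,x,y\right]=\frac1{(2\pi i)^2}\int_{\mathcal C_1}\int_{\mathcal C_2}\frac{\Gamma(\alpha+As)}{\Gamma(s)}\Gamma(-t)\Gamma(\beta-Bt)\Gamma(s+t)\,x^s y^t\,dt\,ds$$ for the bivariate Fox H-function with these parameters, where $\mathcal C_1,\mathcal C_2$ are upward vertical lines that separate the poles: $\operatorname{Re}(\alpha+As)>0$, $\operatorname{Re}t<0$, $\operatorname{Re}(\beta-Bt)>0$, $\operatorname{Re}(s+t)>0$. Such lines exist. For the parameters and arguments occurring below, the integral converges absolutely for all of them, and its value does not depend on their choice. The law of $\gamma$ is absolutely continuous, with a nonnegative density $f_\gamma$ that vanishes on $(-\infty,0]$ and is given for every $\gamma>0$ by $$\begin{aligned}f_\gamma(\gamma)={}&\frac{\omega_1\omega_2}{\gamma}\,\mathcal H_{1,r_1;1,r_2}\Big(\frac{\lambda_1^{r_1}\mu_{r_1}}{\gamma},\frac{C}{\lambda_2^{r_2}\mu_{r_2}}\Big)+\frac{\omega_1(1-\omega_2)}{\Gamma(a_2)\gamma}\,\mathcal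 H_{1,r_1;a_2,r_2/c_2}\Big(\frac{\lambda_1^{r_1}\mu_{r_1}}{\gamma},\frac{C}{b_2^{r_2}\mu_{r_2}}\Big)\\&+\frac{\omega_2(1-\omega_1)}{\Gamma(a_1)\gamma}\,\mathcal H_{a_1,r_1/c_1;1,r_2}\Big(\frac{b_1^{r_1}\mu_{r_1}}{\gamma},\frac{C}{\lambda_2^{r_2}\mu_{r_2}}\Big)+\frac{(1-\omega_1)(1-\omega_2)}{\Gamma(a_1)\Gamma(a_2)\gamma}\,\mathcal H_{a_1,r_1/c_1;a_2,r_2/c_2}\Big(\frac{b_1^{r_1}\mu_{r_1}}{\gamma},\frac{C}{b_2^{r_2}\mu_{r_2}}\Big).\end{aligned}$$ Moreover, the cumulative distribution function of $\gamma$ is differentiable at every point of $(0,\infty)$, with derivative $f_\gamma$. -/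

import Mathlib

open MeasureTheory ProbabilityTheory

noncomputable section

/-! ### Fox's H-function of two variables -/

/-- Parameters attached to one of the two variables of a bivariate Fox H-function
`H^{…:m,n:…}_{…:p,q:…}`: the upper parameters `(c_j, γ_j)`, `j ≤ n` (`upperNum`) and
`n < j ≤ p` (`upperDen`), and the lower parameters `(d_j, δ_j)`, `j ≤ m` (`lowerNum`) and
`m < j ≤ q` (`lowerDen`). The indices `m, n, p, q` are read off from the lengths of the lists. -/
structure FoxParams where
  upperNum : List (ℂ × ℝ)
  upperDen : List (ℂ × ℝ)
  lowerNum : List (ℂ × ℝ)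
  lowerDen : List (ℂ × ℝ)

/-- Parameters attached to both variables jointly in `H^{0,n:…}_{p,q:…}`: the upper ones
`(a_j; α_j, A_j)`, `j ≤ n` (`upperNum`) and `n < j ≤ p` (`upperDen`), and the lower ones
`(b_j; β_j, B_j)`, `j ≤ q` (`lower`). -/
structure FoxJointParams where
  upperNum : List (ℂ × ℝ × ℝ)
  upperDen : List (ℂ × ℝ × ℝ)
  lower : List (ℂ × ℝ × ℝ)

/-- `∏_{j≤m} Γ(d_j - δ_j s) ∏_{j≤n} Γ(1 - c_j + γ_j s) /
(∏_{j>m} Γ(1 - d_j + δ_j s) ∏_{j>n} Γ(c_j - γ_j s))`. -/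
def FoxParams.kernel (A : FoxParams) (s : ℂ) : ℂ :=
  ((A.lowerNum.map fun d => Complex.Gamma (d.1 - d.2 * s)).prod *
    (A.upperNum.map fun c => Complex.Gamma (1 - c.1 + c.2 * s)).prod) /
  ((A.lowerDen.map fun d => Complex.Gamma (1 - d.1 + d.2 * s)).prod *
    (A.upperDen.map fun c => Complex.Gamma (c.1 - c.2 * s)).prod)

/-- `∏_{j≤n} Γ(1 - a_j + α_j s + A_j t) /
(∏_{j>n} Γ(a_j - α_j s - A_j t) ∏_{j≤q} Γ(1 - b_j + β_j s + B_j t))`. -/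
def FoxJointParams.kernel (J : FoxJointParams) (s t : ℂ) : ℂ :=
  (J.upperNum.map fun a => Complex.Gamma (1 - a.1 + a.2.1 * s + a.2.2 * t)).prod /
  ((J.upperDen.map fun a => Complex.Gamma (a.1 - a.2.1 * s - a.2.2 * t)).prod *
    (J.lower.map fun b => Complex.Gamma (1 - b.1 + b.2.1 * s + b.2.2 * t)).prod)

/-- The vertical line of abscissa `σ` has the poles of all `Γ(1 - c_j + γ_j s)` strictly on its
left and those of all `Γ(d_j - δ_j s)` strictly on its right (the coefficients being positive). -/
def FoxParams.Separates (A : FoxParams) (σ : ℝ) : Prop :=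
  (∀ c ∈ A.upperNum, 0 < 1 - c.1.re + c.2 * σ) ∧ (∀ d ∈ A.lowerNum, 0 < d.1.re - d.2 * σ)

/-- The vertical lines `Re s = σ`, `Re t = τ` are admissible Mellin-Barnes contours: besides the
separation in each variable, the poles of the `Γ(1 - a_j + α_j s + A_j t)` lie on the left. -/
def FoxSeparates (J : FoxJointParams) (A B : FoxParams) (σ τ : ℝ) : Prop :=
  (∀ a ∈ J.upperNum, 0 < 1 - a.1.re + a.2.1 * σ + a.2.2 * τ) ∧ A.Separates σ ∧ B.Separates τ

/-- The Mellin-Barnes integrand. -/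
def foxIntegrand (J : FoxJointParams) (A B : FoxParams) (x y : ℝ) (s t : ℂ) : ℂ :=
  J.kernel s t * A.kernel s * B.kernel t * (x : ℂ) ^ s * (y : ℂ) ^ t

/-- `(2πi)⁻² ∫_{Re s = σ} ∫_{Re t = τ} (integrand) dt ds`, with `s = σ + i u`, `t = τ + i v`. -/
def foxContourIntegral (J : FoxJointParams) (A B : FoxParams) (x y σ τ : ℝ) : ℂ :=
  1 / (2 * Real.pi * Complex.I) ^ 2 *
    ∫ u : ℝ, (∫ v : ℝ, foxIntegrand J A B x y (σ + u * Complex.I) (τ + v * Complex.I)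
      * Complex.I) * Complex.I

open Classical in
/-- Fox's H-function of two variables `H[J | A | B | x, y]` for `x, y > 0`: the Mellin-Barnes
integral along vertical lines that separate the poles. -/
def bivariateFoxH (J : FoxJointParams) (A B : FoxParams) (x y : ℝ) : ℂ :=
  if h : ∃ z : ℝ × ℝ, FoxSeparates J A B z.1 z.2 then
    foxContourIntegral J A B x y h.choose.1 h.choose.2
  else 0

/-- `H[J | A | B | x, y]` is well defined: separating lines exist, and along any of them the
integral converges absolutely to one and the same value. -/
def BivariateFoxHConverges (J : FoxJointParams) (A B : FoxParams) (x y : ℝ) : Prop :=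
  (∃ σ τ : ℝ, FoxSeparates J A B σ τ) ∧
  ∀ σ τ : ℝ, FoxSeparates J A B σ τ →
    Integrable (fun z : ℝ × ℝ =>
      foxIntegrand J A B x y (σ + z.1 * Complex.I) (τ + z.2 * Complex.I)) ∧
    foxContourIntegral J A B x y σ τ = bivariateFoxH J A B x y

/-! ### The channel model -/

/-- Parameters of a mixture Exponential-Generalized Gamma (EGG) distribution. -/
structure EGGParams where
  ω : ℝ
  lam : ℝ
  a : ℝ
  b : ℝ
  c : ℝ
  ω_pos : 0 < ω
  ω_lt_one : ω < 1
  lam_pos : 0 < lam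
  a_pos : 0 < a
  b_pos : 0 < b
  c_pos : 0 < c

/-- The density of the EGG distribution, supported on the positive half-line. -/
def eggPDF (p : EGGParams) (x : ℝ) : ℝ :=
  if 0 < x then
    p.ω / p.lam * Real.exp (-(x / p.lam)) +
      (1 - p.ω) * (p.c * x ^ (p.a * p.c - 1) / (p.b ^ (p.a * p.c) * Real.Gamma p.a)) *
        Real.exp (-((x / p.b) ^ p.c))
  else 0

/-- The EGG distribution. -/
def eggMeasure (p : EGGParams) : Measure ℝ :=
  volume.withDensity fun x => ENNReal.ofReal (eggPDF p x)

/-- The instantaneous SNR `(η I)^r / N₀` of a hop with irradiance `I`, conversion ratio `η`,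
noise power `N₀` and detection type `r` (`1`: heterodyne, `2`: IM/DD). -/
def hopSNR {Ω : Type*} (η N₀ : ℝ) (r : ℕ) (I : Ω → ℝ) (w : Ω) : ℝ :=
  (η * I w) ^ r / N₀

/-- The average electrical SNR `μ_r = η^r / N₀` of a hop, i.e. the SNR at normalized mean
irradiance `1`. -/
def avgElectricalSNR (η N₀ : ℝ) (r : ℕ) : ℝ :=
  η ^ r / N₀

/-- The end-to-end SNR `γ₁ γ₂ / (γ₂ + C)` of a dual-hop link with a fixed-gain relay. -/
def endToEndSNR {Ω : Type*} (C : ℝ) (γ₁ γ₂ : Ω → ℝ) (w : Ω) : ℝ :=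
  γ₁ w * γ₂ w / (γ₂ w + C)

/-- The expressions of `μ` through the mean SNR: `μ = E[γ]` for `r = 1` and irradiance of mean
`1`, and `μ = E[γ] / (2 ω λ² + b² (1 - ω) Γ(a + 2/c) / Γ(a))` for `r = 2`. -/
def AvgElectricalSNRSpec {Ω : Type*} [MeasurableSpace Ω] (P : Measure Ω) (p : EGGParams)
    (r : ℕ) (I γ : Ω → ℝ) (μ : ℝ) : Prop :=
  (r = 1 → ∫ w, I w ∂P = 1 → μ = ∫ w, γ w ∂P) ∧
  (r = 2 → μ = (∫ w, γ w ∂P) /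
    (2 * p.ω * p.lam ^ 2 + p.b ^ 2 * (1 - p.ω) * Real.Gamma (p.a + 2 / p.c) / Real.Gamma p.a))

/-! ### The four H-functions of the density -/

/-- `(1; 1, 1)` above, nothing below. -/
def jointPar : FoxJointParams := ⟨[(1, 1, 1)], [], []⟩

/-- First variable, exponential component: `(0, r)` above, `(1, 1)` below; `m = 0`, `n = 1`. -/
def firstExpPar (r : ℕ) : FoxParams := ⟨[(0, (r : ℝ))], [], [], [(1, 1)]⟩

/-- First variable, generalized Gamma component: `(1 - a, r / c)` above, `(1, 1)` below;
`m = 0`, `n = 1`. -/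
def firstGGPar (p : EGGParams) (r : ℕ) : FoxParams :=
  ⟨[(1 - (p.a : ℂ), (r : ℝ) / p.c)], [], [], [(1, 1)]⟩

/-- Second variable, exponential component: nothing above, `(0, 1), (1, r)` below;
`m = 2`, `n = 0`. -/
def secondExpPar (r : ℕ) : FoxParams := ⟨[], [], [(0, 1), (1, (r : ℝ))], []⟩

/-- Second variable, generalized Gamma component: nothing above, `(0, 1), (a, r / c)` below;
`m = 2`, `n = 0`. -/
def secondGGPar (p : EGGParams) (r : ℕ) : FoxParams :=
  ⟨[], [], [(0, 1), ((p.a : ℂ), (r : ℝ) / p.c)], []⟩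

/-- The closed form of the density of the end-to-end SNR at `x > 0`. -/
def endToEndSNRDensity (p₁ p₂ : EGGParams) (r₁ r₂ : ℕ) (μ₁ μ₂ C x : ℝ) : ℂ :=
  (p₁.ω * p₂.ω / x : ℝ) *
      bivariateFoxH jointPar (firstExpPar r₁) (secondExpPar r₂)
        (p₁.lam ^ r₁ * μ₁ / x) (C / (p₂.lam ^ r₂ * μ₂)) +
  (p₁.ω * (1 - p₂.ω) / (Real.Gamma p₂.a * x) : ℝ) *
      bivariateFoxH jointPar (firstExpPar r₁) (secondGGPar p₂ r₂)
        (p₁.lam ^ r₁ * μ₁ / x) (C / (p₂.b ^ r₂ * μ₂)) +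
  (p₂.ω * (1 - p₁.ω) / (Real.Gamma p₁.a * x) : ℝ) *
      bivariateFoxH jointPar (firstGGPar p₁ r₁) (secondExpPar r₂)
        (p₁.b ^ r₁ * μ₁ / x) (C / (p₂.lam ^ r₂ * μ₂)) +
  ((1 - p₁.ω) * (1 - p₂.ω) / (Real.Gamma p₁.a * Real.Gamma p₂.a * x) : ℝ) *
      bivariateFoxH jointPar (firstGGPar p₁ r₁) (secondGGPar p₂ r₂)
        (p₁.b ^ r₁ * μ₁ / x) (C / (p₂.b ^ r₂ * μ₂))

/-- Well-definedness of the four H-functions in the closed form of the density at `x`. -/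
def EndToEndSNRDensityConverges (p₁ p₂ : EGGParams) (r₁ r₂ : ℕ) (μ₁ μ₂ C x : ℝ) : Prop :=
  BivariateFoxHConverges jointPar (firstExpPar r₁) (secondExpPar r₂)
      (p₁.lam ^ r₁ * μ₁ / x) (C / (p₂.lam ^ r₂ * μ₂)) ∧
  BivariateFoxHConverges jointPar (firstExpPar r₁) (secondGGPar p₂ r₂)
      (p₁.lam ^ r₁ * μ₁ / x) (C / (p₂.b ^ r₂ * μ₂)) ∧
  BivariateFoxHConverges jointPar (firstGGPar p₁ r₁) (secondExpPar r₂)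
      (p₁.b ^ r₁ * μ₁ / x) (C / (p₂.lam ^ r₂ * μ₂)) ∧
  BivariateFoxHConverges jointPar (firstGGPar p₁ r₁) (secondGGPar p₂ r₂)
      (p₁.b ^ r₁ * μ₁ / x) (C / (p₂.b ^ r₂ * μ₂))

end

/-!
Each component of an irradiance is a scaled power of a Gamma variable, hence so is each component
of a hop SNR. Conditionally on the second hop, `γ₁γ₂/(γ₂ + C) = γ₁ (1 + C/γ₂)⁻¹` is a scaling of
`γ₁`, so the density of a component of `γ` is an expectation, over the Gamma variable `G` of the
second hop, of the density of the first hop at a multiple of `1 + y G^(-B)`. The H-functions are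
these expectations: the coupling factor `Γ(-t)Γ(s+t)/Γ(s)` is the Beta integral `B(-t, s+t)`, the
Mellin transform of `(1 + z)^(-s)` at `-t`, so Mellin inversion in `t` followed by Mellin inversion
in `s` collapses the double contour integral to the expectation. A Beta integral is bounded by its
value at the real parts, so the double integral converges absolutely because `Γ` is integrable on
vertical lines.
-/

noncomputable section

open Set Filter Topology
open scoped ENNReal

/-! ### The Gamma and Beta functions on vertical lines -/

lemma norm_Gamma_le_Gamma_re {z : ℂ} (hz : 0 < z.re) :
    ‖Complex.Gamma z‖ ≤ Real.Gamma z.re := by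
  rw [Complex.Gamma_eq_integral hz, Complex.GammaIntegral, Real.Gamma_eq_integral hz]
  refine (norm_integral_le_integral_norm _).trans_eq
    (setIntegral_congr_fun measurableSet_Ioi fun x (hx : 0 < x) => ?_)
  simp [Complex.norm_cpow_eq_rpow_re_of_pos hx, Complex.norm_exp]

lemma norm_betaIntegral_le (u v : ℂ) :
    ‖Complex.betaIntegral u v‖ ≤ ∫ x in (0 : ℝ)..1, x ^ (u.re - 1) * (1 - x) ^ (v.re - 1) := by
  rw [Complex.betaIntegral, intervalIntegral.integral_of_le zero_le_one,
    intervalIntegral.integral_of_le zero_le_one, integral_Ioc_eq_integral_Ioo,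
    integral_Ioc_eq_integral_Ioo]
  refine (norm_integral_le_integral_norm _).trans_eq
    (setIntegral_congr_fun measurableSet_Ioo fun x hx => ?_)
  rw [norm_mul, ← Complex.ofReal_one, ← Complex.ofReal_sub,
    Complex.norm_cpow_eq_rpow_re_of_pos hx.1, Complex.norm_cpow_eq_rpow_re_of_pos (sub_pos.2 hx.2),
    Complex.sub_re, Complex.sub_re, Complex.ofReal_re]

lemma continuous_Gamma_comp {X : Type*} [TopologicalSpace X] {f : X → ℂ}
    (hf : Continuous f) (hre : ∀ x, 0 < (f x).re) : Continuous fun x => Complex.Gamma (f x) := by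
  refine continuous_iff_continuousAt.2 fun x => ?_
  refine ContinuousAt.comp (f := f) (Complex.differentiableAt_Gamma _ fun m hm => ?_).continuousAt
    hf.continuousAt
  have hpos := hre x
  rw [hm, Complex.neg_re, Complex.natCast_re] at hpos
  linarith [Nat.cast_nonneg (α := ℝ) m]

lemma norm_sq_mul_norm_Gamma_le {z : ℂ} (hz : 0 < z.re) :
    ‖z‖ ^ 2 * ‖Complex.Gamma z‖ ≤ Real.Gamma (z.re + 2) := by
  have hz0 : z ≠ 0 := fun h => by simp [h] at hz
  have hz1 : z + 1 ≠ 0 := fun h => by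
    have : (z + 1).re = 0 := by rw [h]; rfl
    rw [Complex.add_re, Complex.one_re] at this
    linarith
  have hnorm : ‖z‖ ≤ ‖z + 1‖ := by
    rw [← sq_le_sq₀ (norm_nonneg _) (norm_nonneg _), ← Complex.normSq_eq_norm_sq,
      ← Complex.normSq_eq_norm_sq, Complex.normSq_apply, Complex.normSq_apply,
      Complex.add_re, Complex.add_im, Complex.one_re, Complex.one_im]
    nlinarith
  calc ‖z‖ ^ 2 * ‖Complex.Gamma z‖ ≤ ‖z + 1‖ * (‖z‖ * ‖Complex.Gamma z‖) := by
        rw [sq, mul_assoc]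
        gcongr
    _ = ‖Complex.Gamma (z + 2)‖ := by
        rw [← norm_mul, ← Complex.Gamma_add_one z hz0, ← norm_mul,
          ← Complex.Gamma_add_one _ hz1, add_assoc, one_add_one_eq_two]
    _ ≤ Real.Gamma (z.re + 2) := by
        simpa using norm_Gamma_le_Gamma_re (z := z + 2) (by simp; linarith)

lemma verticalIntegrable_Gamma {σ : ℝ} (hσ : 0 < σ) :
    Complex.VerticalIntegrable Complex.Gamma σ := by
  refine (integrable_inv_one_add_sq.const_mul (Real.Gamma (σ + 2) / min (σ ^ 2) 1)).mono'
    (continuous_Gamma_comp (by fun_prop) (by simp [hσ])).aestronglyMeasurable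
    (.of_forall fun u => ?_)
  have hGamma := norm_sq_mul_norm_Gamma_le (z := σ + u * Complex.I) (by simpa using hσ)
  rw [← Complex.normSq_eq_norm_sq, Complex.normSq_add_mul_I] at hGamma
  rw [← div_eq_mul_inv, div_div, le_div_iff₀ (by positivity), mul_comm]
  calc min (σ ^ 2) 1 * (1 + u ^ 2) * ‖Complex.Gamma (σ + u * Complex.I)‖
      ≤ (σ ^ 2 + u ^ 2) * ‖Complex.Gamma (σ + u * Complex.I)‖ := by
        gcongr
        nlinarith [min_le_left (σ ^ 2) 1, min_le_right (σ ^ 2) 1, sq_nonneg u]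
    _ ≤ Real.Gamma (σ + 2) := by simpa using hGamma

lemma verticalIntegrable_Gamma_add_mul {α A σ : ℝ} (hA : A ≠ 0) (h : 0 < α + A * σ) :
    Complex.VerticalIntegrable (fun s => Complex.Gamma (α + A * s)) σ := by
  refine ((verticalIntegrable_Gamma h).comp_mul_left' hA).congr (.of_forall fun u => ?_)
  push_cast
  ring_nf

lemma image_div_one_add_Ioi : (fun z : ℝ => z / (1 + z)) '' Ioi 0 = Ioo 0 1 := by
  ext x
  constructor
  · rintro ⟨z, hz : 0 < z, rfl⟩
    exact ⟨by positivity, (div_lt_one (by positivity)).2 (by linarith)⟩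
  · rintro ⟨hx0, hx1⟩
    have : 0 < 1 - x := sub_pos.2 hx1
    exact ⟨x / (1 - x), div_pos hx0 this, by field_simp; ring⟩

lemma injOn_div_one_add_Ioi : InjOn (fun z : ℝ => z / (1 + z)) (Ioi 0) := by
  intro y (hy : 0 < y) z (hz : 0 < z) h
  have : y / (1 + y) = z / (1 + z) := h
  field_simp at this
  linarith

lemma hasDerivAt_div_one_add {z : ℝ} (hz : 1 + z ≠ 0) :
    HasDerivAt (fun z : ℝ => z / (1 + z)) ((1 + z) ^ 2)⁻¹ z := by
  refine ((hasDerivAt_id' z).div ((hasDerivAt_id' z).const_add 1) hz).congr_deriv ?_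
  rw [one_mul, mul_one, add_sub_cancel_right, one_div]

lemma cpow_mul_one_add_cpow_neg {z : ℝ} (hz : 0 < z) (s w : ℂ) :
    (z : ℂ) ^ (w - 1) • ((1 + z : ℝ) : ℂ) ^ (-s) =
      |((1 + z) ^ 2)⁻¹| • (((z / (1 + z) : ℝ) : ℂ) ^ (w - 1) *
        (1 - ((z / (1 + z) : ℝ) : ℂ)) ^ (s - w - 1)) := by
  have h1z : 0 < 1 + z := by positivity
  have h1z' : ((1 + z : ℝ) : ℂ) ≠ 0 := by exact_mod_cast h1z.ne'
  have hcompl : 1 - ((z / (1 + z) : ℝ) : ℂ) = (((1 + z)⁻¹ : ℝ) : ℂ) := by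
    rw [← Complex.ofReal_one, ← Complex.ofReal_sub]
    congr 1
    field_simp
    exact add_sub_cancel_right 1 z
  have hinv (v : ℂ) : (((1 + z)⁻¹ : ℝ) : ℂ) ^ v = ((1 + z : ℝ) : ℂ) ^ (-v) := by
    rw [Complex.ofReal_inv, Complex.inv_cpow _ _ (by
      rw [Complex.arg_ofReal_of_nonneg h1z.le]; exact Real.pi_ne_zero.symm), Complex.cpow_neg]
  have hsq : ((((1 + z) ^ 2)⁻¹ : ℝ) : ℂ) = ((1 + z : ℝ) : ℂ) ^ (-2 : ℂ) := by
    rw [Complex.cpow_neg, Complex.cpow_ofNat]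
    push_cast
    rfl
  rw [hcompl, abs_of_pos (by positivity), Complex.real_smul, hsq, div_eq_mul_inv,
    Complex.ofReal_mul, Complex.mul_cpow_ofReal_nonneg hz.le (by positivity), hinv, hinv,
    smul_eq_mul, mul_assoc, mul_left_comm, ← Complex.cpow_add _ _ h1z', ← Complex.cpow_add _ _ h1z']
  ring_nf

theorem hasMellin_one_add_cpow_neg {s w : ℂ} (hw : 0 < w.re) (hs : w.re < s.re) :
    HasMellin (fun z : ℝ => ((1 + z : ℝ) : ℂ) ^ (-s)) w (Complex.betaIntegral w (s - w)) := by
  have hderiv : ∀ z ∈ Ioi (0 : ℝ),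
      HasDerivWithinAt (fun z : ℝ => z / (1 + z)) ((1 + z) ^ 2)⁻¹ (Ioi 0) z := fun z hz =>
    (hasDerivAt_div_one_add (by linarith [mem_Ioi.1 hz])).hasDerivWithinAt
  have hconv := Complex.betaIntegral_convergent hw (v := s - w) (by simpa using hs)
  rw [intervalIntegrable_iff_integrableOn_Ioo_of_le zero_le_one, ← image_div_one_add_Ioi,
    integrableOn_image_iff_integrableOn_abs_deriv_smul measurableSet_Ioi hderiv
      injOn_div_one_add_Ioi] at hconv
  refine ⟨hconv.congr_fun (fun z hz => (cpow_mul_one_add_cpow_neg hz s w).symm)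
    measurableSet_Ioi, ?_⟩
  rw [Complex.betaIntegral, intervalIntegral.integral_of_le zero_le_one,
    integral_Ioc_eq_integral_Ioo, ← image_div_one_add_Ioi,
    integral_image_eq_integral_abs_deriv_smul measurableSet_Ioi hderiv injOn_div_one_add_Ioi]
  exact setIntegral_congr_fun measurableSet_Ioi fun z hz => cpow_mul_one_add_cpow_neg hz s w

lemma verticalIntegrable_betaIntegral {s : ℂ} {σ : ℝ} (hσ : 0 < σ) (hs : σ < s.re) :
    Complex.VerticalIntegrable (fun w => Complex.betaIntegral w (s - w)) σ := by
  have hGamma (u : ℝ) : Complex.betaIntegral (σ + u * Complex.I) (s - (σ + u * Complex.I)) =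
      Complex.Gamma (σ + u * Complex.I) * Complex.Gamma (s - (σ + u * Complex.I)) /
        Complex.Gamma s := by
    rw [Complex.betaIntegral_eq_Gamma_mul_div _ _ (by simpa using hσ) (by simpa using hs),
      add_sub_cancel]
  simp only [Complex.VerticalIntegrable, hGamma]
  refine ((verticalIntegrable_Gamma hσ).mul_bdd (c := Real.Gamma (s.re - σ))
    (continuous_Gamma_comp (by fun_prop) (by simpa using hs)).aestronglyMeasurable
    (.of_forall fun u => ?_)).div_const _
  simpa using norm_Gamma_le_Gamma_re (z := s - (σ + u * Complex.I)) (by simpa using hs)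

/-! ### Mellin-Barnes double integrals -/

section Inversion

variable {f : ℝ → ℂ} {m : ℂ → ℂ} {σ : ℝ}

lemma integral_vertical_mul_cpow_neg (hm : ∀ s : ℂ, s.re = σ → HasMellin f s (m s))
    (hint : Complex.VerticalIntegrable m σ) {x : ℝ} (hx : 0 < x) (hf : ContinuousAt f x) :
    ∫ u : ℝ, m (σ + u * Complex.I) * (x : ℂ) ^ (-(σ + u * Complex.I)) = 2 * Real.pi * f x := by
  have hmellin (u : ℝ) : mellin f (σ + u * Complex.I) = m (σ + u * Complex.I) :=
    (hm _ (by simp)).2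
  rw [← mellinInv_mellin_eq σ f hx (hm σ rfl).1 (by simpa only [Complex.VerticalIntegrable, hmellin]
    using hint) hf, mellinInv, Complex.real_smul]
  push_cast
  rw [← mul_assoc, mul_one_div_cancel (by simp [Real.pi_ne_zero]), one_mul]
  refine integral_congr_ae (.of_forall fun u => ?_)
  dsimp only
  rw [hmellin, smul_eq_mul, mul_comm]

theorem integral_vertical_mul_integral_cpow_neg {X : Type*} [MeasurableSpace X] {ρ : Measure X}
    [SFinite ρ] {K : X → ℝ} (hm : ∀ s : ℂ, s.re = σ → HasMellin f s (m s))
    (hint : Complex.VerticalIntegrable m σ) (hf : ContinuousOn f (Ioi 0))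
    (hKm : Measurable K) (hK : ∀ᵐ g ∂ρ, 0 < K g) (hKint : Integrable (fun g => K g ^ (-σ)) ρ) :
    ∫ u : ℝ, m (σ + u * Complex.I) * ∫ g, (K g : ℂ) ^ (-(σ + u * Complex.I)) ∂ρ =
      2 * Real.pi * ∫ g, f (K g) ∂ρ := by
  have hprod : Integrable (fun z : ℝ × X =>
      m (σ + z.1 * Complex.I) * (K z.2 : ℂ) ^ (-(σ + z.1 * Complex.I))) (volume.prod ρ) := by
    refine (hint.norm.mul_prod hKint).mono' (hint.aestronglyMeasurable.comp_fst.mul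
      (by fun_prop : Measurable _).aestronglyMeasurable) ?_
    filter_upwards [Measure.quasiMeasurePreserving_snd.ae hK] with z hz
    rw [norm_mul, Complex.norm_cpow_eq_rpow_re_of_pos hz]
    simp
  simp only [← integral_const_mul]
  rw [integral_integral_swap hprod]
  refine integral_congr_ae ?_
  filter_upwards [hK] with g hg
  exact integral_vertical_mul_cpow_neg hm hint hg (hf.continuousAt (Ioi_mem_nhds hg))

end Inversion

section MellinBarnes

variable {X : Type*} [MeasurableSpace X] {ρ : Measure X} {Q : X → ℝ} {φ : ℝ → ℂ} {m M : ℂ → ℂ}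
  {σ τ x y : ℝ}

lemma continuous_betaIntegral_comp {Y : Type*} [TopologicalSpace Y] {f g : Y → ℂ}
    (hf : Continuous f) (hg : Continuous g) (hf0 : ∀ y, 0 < (f y).re) (hg0 : ∀ y, 0 < (g y).re) :
    Continuous fun y => Complex.betaIntegral (f y) (g y) := by
  have hfg0 (y : Y) : 0 < (f y + g y).re := by
    rw [Complex.add_re]
    exact add_pos (hf0 y) (hg0 y)
  simp only [fun y => Complex.betaIntegral_eq_Gamma_mul_div (f y) (g y) (hf0 y) (hg0 y)]
  exact ((continuous_Gamma_comp hf hf0).mul (continuous_Gamma_comp hg hg0)).div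
    (continuous_Gamma_comp (hf.add hg) hfg0) fun y => Complex.Gamma_ne_zero_of_re_pos (hfg0 y)

lemma verticalIntegrable_mul_cpow (hm : Complex.VerticalIntegrable m σ) (hx : 0 < x) :
    Complex.VerticalIntegrable (fun s => m s * (x : ℂ) ^ s) σ :=
  Integrable.mul_bdd (c := x ^ σ) hm (Continuous.const_cpow (by fun_prop)
    (.inl (Complex.ofReal_ne_zero.2 hx.ne'))).aestronglyMeasurable
    (.of_forall fun u => by simp [Complex.norm_cpow_eq_rpow_re_of_pos hx])

/-- The Mellin-Barnes integrand `Γ(-t) Γ(s + t) / Γ(s) · m(s) M(t) x^s y^t`, its coupling factor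
being written as a Beta integral. Two Mellin inversions evaluate its double contour integral. -/
def mellinBarnesIntegrand (m M : ℂ → ℂ) (x y : ℝ) (s t : ℂ) : ℂ :=
  Complex.betaIntegral (-t) (s + t) * (m s * (x : ℂ) ^ s) * (M t * (y : ℂ) ^ t)

theorem integrable_mellinBarnesIntegrand (hτ : τ < 0) (hστ : 0 < σ + τ) (hx : 0 < x) (hy : 0 < y)
    (hm : Complex.VerticalIntegrable m σ) (hM : Complex.VerticalIntegrable M τ) :
    Integrable fun z : ℝ × ℝ =>
      mellinBarnesIntegrand m M x y (σ + z.1 * Complex.I) (τ + z.2 * Complex.I) := by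
  have hmM := Integrable.mul_prod (verticalIntegrable_mul_cpow hm hx)
    (verticalIntegrable_mul_cpow hM hy)
  have hbeta : Continuous fun z : ℝ × ℝ => Complex.betaIntegral (-(τ + z.2 * Complex.I))
      (σ + z.1 * Complex.I + (τ + z.2 * Complex.I)) :=
    continuous_betaIntegral_comp (by fun_prop) (by fun_prop) (by simpa) (by simpa)
  have hbound (z : ℝ × ℝ) : ‖Complex.betaIntegral (-(τ + z.2 * Complex.I))
      (σ + z.1 * Complex.I + (τ + z.2 * Complex.I))‖ ≤
      ∫ p in (0 : ℝ)..1, p ^ (-τ - 1) * (1 - p) ^ (σ + τ - 1) := by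
    simpa using norm_betaIntegral_le (-(τ + z.2 * Complex.I))
      (σ + z.1 * Complex.I + (τ + z.2 * Complex.I))
  refine (hmM.bdd_mul hbeta.aestronglyMeasurable (.of_forall hbound)).congr (.of_forall fun z => ?_)
  exact (mul_assoc _ _ _).symm

lemma integral_mul_const_cpow (hQ : ∀ᵐ g ∂ρ, 0 < Q g) (hy : 0 < y) (t : ℂ) :
    ∫ g, ((Q g * y : ℝ) : ℂ) ^ t ∂ρ = (∫ g, (Q g : ℂ) ^ t ∂ρ) * (y : ℂ) ^ t := by
  rw [← integral_mul_const]
  refine integral_congr_ae ?_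
  filter_upwards [hQ] with g hg
  rw [Complex.ofReal_mul, Complex.mul_cpow_ofReal_nonneg hg.le hy.le]

lemma continuousOn_one_add_cpow (s : ℂ) :
    ContinuousOn (fun z : ℝ => ((1 + z : ℝ) : ℂ) ^ s) (Ioi 0) :=
  ContinuousOn.cpow_const (by fun_prop) fun z (hz : 0 < z) =>
    Complex.ofReal_mem_slitPlane.2 (by positivity)

theorem integral_vertical_betaIntegral_mul_cpow [SFinite ρ] {s : ℂ} (hτ : τ < 0)
    (hs : 0 < s.re + τ) (hy : 0 < y) (hQm : Measurable Q) (hQ : ∀ᵐ g ∂ρ, 0 < Q g)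
    (hQint : Integrable (fun g => Q g ^ τ) ρ) :
    ∫ v : ℝ, Complex.betaIntegral (-(τ + v * Complex.I)) (s + (τ + v * Complex.I)) *
        ((∫ g, (Q g : ℂ) ^ (τ + v * Complex.I) ∂ρ) * (y : ℂ) ^ (τ + v * Complex.I)) =
      2 * Real.pi * ∫ g, ((1 + Q g * y : ℝ) : ℂ) ^ (-s) ∂ρ := by
  have hK : ∀ᵐ g ∂ρ, 0 < Q g * y := hQ.mono fun g hg => mul_pos hg hy
  have hKint : Integrable (fun g => (Q g * y) ^ (-(-τ))) ρ := by
    refine (hQint.mul_const (y ^ τ)).congr ?_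
    filter_upwards [hQ] with g hg
    rw [neg_neg, Real.mul_rpow hg.le hy.le]
  rw [← integral_vertical_mul_integral_cpow_neg (σ := -τ)
    (fun w hw => hasMellin_one_add_cpow_neg (s := s) (by linarith) (by linarith))
    (verticalIntegrable_betaIntegral (by linarith) (by linarith)) (continuousOn_one_add_cpow _)
    (hQm.mul_const y) hK hKint, ← integral_neg_eq_self]
  refine integral_congr_ae (.of_forall fun v => ?_)
  have hneg : ((-τ : ℝ) : ℂ) + v * Complex.I = -(τ + (-v : ℝ) * Complex.I) := by
    push_cast
    ring
  dsimp only
  rw [hneg, sub_neg_eq_add, neg_neg, integral_mul_const_cpow hQ hy]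

lemma integral_div_cpow_neg {K : X → ℝ} (hK : ∀ᵐ g ∂ρ, 0 < K g) (hx : 0 < x) (s : ℂ) :
    ∫ g, ((K g / x : ℝ) : ℂ) ^ (-s) ∂ρ = (∫ g, (K g : ℂ) ^ (-s) ∂ρ) * (x : ℂ) ^ s := by
  have harg : (x : ℂ).arg ≠ Real.pi := by
    rw [Complex.arg_ofReal_of_nonneg hx.le]
    exact Real.pi_ne_zero.symm
  simp only [div_eq_mul_inv]
  rw [integral_mul_const_cpow hK (inv_pos.2 hx), Complex.ofReal_inv, Complex.inv_cpow _ _ harg,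
    Complex.cpow_neg, inv_inv]

theorem integral_integral_mellinBarnesIntegrand [IsFiniteMeasure ρ] (hτ : τ < 0)
    (hστ : 0 < σ + τ) (hx : 0 < x) (hy : 0 < y) (hφm : ∀ s : ℂ, s.re = σ → HasMellin φ s (m s))
    (hm : Complex.VerticalIntegrable m σ) (hφ : ContinuousOn φ (Ioi 0))
    (hQm : Measurable Q) (hQ : ∀ᵐ g ∂ρ, 0 < Q g) (hQint : Integrable (fun g => Q g ^ τ) ρ)
    (hQM : ∀ t : ℂ, t.re = τ → ∫ g, (Q g : ℂ) ^ t ∂ρ = M t) :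
    ∫ u : ℝ, ∫ v : ℝ,
        mellinBarnesIntegrand m M x y (σ + u * Complex.I) (τ + v * Complex.I) =
      (2 * Real.pi) ^ 2 * ∫ g, φ ((1 + Q g * y) / x) ∂ρ := by
  have hK : ∀ᵐ g ∂ρ, 1 < 1 + Q g * y := by
    filter_upwards [hQ] with g hg
    linarith [mul_pos hg hy]
  have hKx : ∀ᵐ g ∂ρ, 0 < (1 + Q g * y) / x := by
    filter_upwards [hK] with g hg
    exact div_pos (zero_lt_one.trans hg) hx
  have hKint : Integrable (fun g => ((1 + Q g * y) / x) ^ (-σ)) ρ := by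
    refine Integrable.of_bound (by fun_prop : Measurable _).aestronglyMeasurable ((1 / x) ^ (-σ)) ?_
    filter_upwards [hK, hKx] with g hg hgx
    rw [Real.norm_of_nonneg (Real.rpow_nonneg hgx.le _)]
    exact Real.rpow_le_rpow_of_nonpos (by positivity) (by gcongr) (by linarith)
  have hinner (u : ℝ) : ∫ v : ℝ,
        mellinBarnesIntegrand m M x y (σ + u * Complex.I) (τ + v * Complex.I) =
      2 * Real.pi * (m (σ + u * Complex.I) *
        ∫ g, (((1 + Q g * y) / x : ℝ) : ℂ) ^ (-(σ + u * Complex.I)) ∂ρ) := by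
    rw [integral_div_cpow_neg (hK.mono fun g hg => zero_lt_one.trans hg) hx, mul_left_comm,
      ← mul_assoc (2 * _), ← integral_vertical_betaIntegral_mul_cpow hτ (by simpa) hy hQm hQ hQint,
      mul_comm (integral _ _), ← mul_assoc, ← integral_const_mul]
    refine integral_congr_ae (.of_forall fun v => ?_)
    simp only [mellinBarnesIntegrand, hQM _ (by simp : (τ + v * Complex.I).re = τ)]
    ring
  simp only [hinner, integral_const_mul]
  rw [integral_vertical_mul_integral_cpow_neg hφm hm hφ (by fun_prop) hKx hKint]
  ring

end MellinBarnes

/-! ### Powers of Gamma variables -/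

section GammaPowers

lemma integrable_withDensity_ofReal_iff {X E : Type*} [MeasurableSpace X] [NormedAddCommGroup E]
    [NormedSpace ℝ E] {μ : Measure X} {f : X → ℝ} {g : X → E} (hf : Measurable f)
    (hf0 : ∀ᵐ x ∂μ, 0 ≤ f x) :
    Integrable g (μ.withDensity fun x => ENNReal.ofReal (f x)) ↔
      Integrable (fun x => f x • g x) μ := by
  rw [integrable_withDensity_iff_integrable_smul' hf.ennreal_ofReal
    (.of_forall fun _ => ENNReal.ofReal_lt_top)]
  exact integrable_congr (hf0.mono fun x hx => by simp only [ENNReal.toReal_ofReal hx])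

lemma integral_withDensity_ofReal {X E : Type*} [MeasurableSpace X] [NormedAddCommGroup E]
    [NormedSpace ℝ E] {μ : Measure X} {f : X → ℝ} (hf : Measurable f)
    (hf0 : ∀ᵐ x ∂μ, 0 ≤ f x) (g : X → E) :
    ∫ x, g x ∂μ.withDensity (fun x => ENNReal.ofReal (f x)) = ∫ x, f x • g x ∂μ := by
  rw [integral_withDensity_eq_integral_toReal_smul hf.ennreal_ofReal
    (.of_forall fun _ => ENNReal.ofReal_lt_top)]
  exact integral_congr_ae (hf0.mono fun x hx => by simp only [ENNReal.toReal_ofReal hx])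

lemma ofReal_rpow_cpow {g : ℝ} (hg : 0 < g) (p : ℝ) (w : ℂ) :
    ((g ^ p : ℝ) : ℂ) ^ w = (g : ℂ) ^ ((p : ℂ) * w) := by
  have him : (Complex.log (g : ℂ) * p).im = 0 := by simp [← Complex.ofReal_log hg.le]
  rw [Complex.ofReal_cpow hg.le, Complex.cpow_mul _ (by simp [him, Real.pi_pos])
    (by simp [him, Real.pi_pos.le])]

lemma gammaMeasure_one_eq_withDensity (α : ℝ) :
    gammaMeasure α 1 = (volume.restrict (Ioi 0)).withDensity fun g =>
      ENNReal.ofReal (g ^ (α - 1) * Real.exp (-g) / Real.Gamma α) := by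
  rw [gammaMeasure, ← withDensity_indicator measurableSet_Ioi]
  refine withDensity_congr_ae ?_
  filter_upwards [Measure.ae_ne volume 0] with g hg
  rcases hg.lt_or_gt with hg | hg
  · rw [gammaPDF_of_neg hg, indicator_of_notMem (notMem_Ioi.2 hg.le)]
  · rw [gammaPDF_of_nonneg hg.le, indicator_of_mem (mem_Ioi.2 hg), Real.one_rpow, one_mul]
    congr 1
    ring

lemma ae_pos_gammaMeasure (α : ℝ) : ∀ᵐ g ∂gammaMeasure α 1, 0 < g := by
  rw [gammaMeasure_one_eq_withDensity]
  exact (withDensity_absolutelyContinuous _ _).ae_le (ae_restrict_mem measurableSet_Ioi)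

section Moments

variable {α : ℝ} {w : ℂ}

lemma ae_gammaDensity_nonneg (hα : 0 < α) :
    ∀ᵐ g ∂volume.restrict (Ioi (0 : ℝ)), 0 ≤ g ^ (α - 1) * Real.exp (-g) / Real.Gamma α := by
  filter_upwards [ae_restrict_mem measurableSet_Ioi] with g (hg : 0 < g)
  positivity

lemma gammaDensity_smul_cpow {g : ℝ} (hg : 0 < g) :
    (g ^ (α - 1) * Real.exp (-g) / Real.Gamma α) • (g : ℂ) ^ w =
      ((Real.exp (-g) : ℝ) * (g : ℂ) ^ (α + w - 1)) / Complex.Gamma α := by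
  rw [add_sub_right_comm, Complex.cpow_add _ _ (Complex.ofReal_ne_zero.2 hg.ne'),
    Complex.real_smul, Complex.Gamma_ofReal]
  push_cast [Complex.ofReal_cpow hg.le]
  ring

lemma integrable_cpow_gammaMeasure (hα : 0 < α) (hw : 0 < α + w.re) :
    Integrable (fun g : ℝ => (g : ℂ) ^ w) (gammaMeasure α 1) := by
  rw [gammaMeasure_one_eq_withDensity, integrable_withDensity_ofReal_iff (by fun_prop)
    (ae_gammaDensity_nonneg hα)]
  exact IntegrableOn.congr_fun
    ((Complex.GammaIntegral_convergent (s := α + w) (by simpa)).div_const _)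
    (fun g hg => (gammaDensity_smul_cpow hg).symm) measurableSet_Ioi

theorem integral_cpow_gammaMeasure (hα : 0 < α) (hw : 0 < α + w.re) :
    ∫ g, (g : ℂ) ^ w ∂gammaMeasure α 1 = Complex.Gamma (α + w) / Complex.Gamma α := by
  rw [gammaMeasure_one_eq_withDensity, integral_withDensity_ofReal (by fun_prop)
    (ae_gammaDensity_nonneg hα), setIntegral_congr_fun measurableSet_Ioi
    fun g hg => gammaDensity_smul_cpow hg, integral_div,
    Complex.Gamma_eq_integral (s := α + w) (by simpa), Complex.GammaIntegral]

lemma integrable_rpow_gammaMeasure {p : ℝ} (hα : 0 < α) (hp : 0 < α + p) :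
    Integrable (fun g : ℝ => g ^ p) (gammaMeasure α 1) := by
  refine (integrable_cpow_gammaMeasure (w := p) hα hp).norm.congr ?_
  filter_upwards [ae_pos_gammaMeasure α] with g hg
  rw [Complex.norm_cpow_eq_rpow_re_of_pos hg, Complex.ofReal_re]

theorem integral_rpow_gammaMeasure {p : ℝ} (hα : 0 < α) (hp : 0 < α + p) :
    ∫ g, g ^ p ∂gammaMeasure α 1 = Real.Gamma (α + p) / Real.Gamma α := by
  have h := integral_cpow_gammaMeasure (w := p) hα hp
  rw [← integral_congr_ae ((ae_pos_gammaMeasure α).mono fun g hg => Complex.ofReal_cpow hg.le p),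
    integral_complex_ofReal, ← Complex.ofReal_add, Complex.Gamma_ofReal, Complex.Gamma_ofReal] at h
  exact_mod_cast h

/-- The moment `Γ(α + A s) / Γ(α)` of order `A s` of a Gamma variable of shape `α`. -/
def gammaMoment (α A : ℝ) (s : ℂ) : ℂ :=
  Complex.Gamma (α + A * s) / Complex.Gamma α

variable {A : ℝ} {s : ℂ}

lemma ae_cpow_eq_rpow_cpow : (fun g : ℝ => (g : ℂ) ^ (A * s)) =ᵐ[gammaMeasure α 1]
    fun g => ((g ^ A : ℝ) : ℂ) ^ s :=
  (ae_pos_gammaMeasure α).mono fun _ hg => (ofReal_rpow_cpow hg A s).symm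

lemma integrable_rpow_cpow_gammaMeasure (hα : 0 < α) (hs : 0 < α + A * s.re) :
    Integrable (fun g : ℝ => ((g ^ A : ℝ) : ℂ) ^ s) (gammaMeasure α 1) :=
  (integrable_cpow_gammaMeasure hα (by simpa)).congr ae_cpow_eq_rpow_cpow

theorem integral_rpow_cpow_gammaMeasure (hα : 0 < α) (hs : 0 < α + A * s.re) :
    ∫ g, ((g ^ A : ℝ) : ℂ) ^ s ∂gammaMeasure α 1 = gammaMoment α A s := by
  rw [← integral_congr_ae ae_cpow_eq_rpow_cpow, integral_cpow_gammaMeasure hα (by simpa)]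
  rfl

lemma verticalIntegrable_gammaMoment {σ : ℝ} (hA : A ≠ 0) (hσ : 0 < α + A * σ) :
    Complex.VerticalIntegrable (gammaMoment α A) σ :=
  Integrable.div_const (verticalIntegrable_Gamma_add_mul hA hσ) _

end Moments

/-- The density with respect to `dz / z` of the power `G ^ A` of a Gamma variable `G` of shape
`α`, so that its Mellin transform at `s` is the moment of order `A * s` of `G`. -/
def powGammaKernel (α A z : ℝ) : ℝ :=
  z ^ (α / A) * Real.exp (-z ^ (1 / A)) / (A * Real.Gamma α)

section Kernel

variable {α A z : ℝ}

lemma powGammaKernel_nonneg (hα : 0 < α) (hA : 0 < A) (hz : 0 < z) :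
    0 ≤ powGammaKernel α A z := by
  unfold powGammaKernel
  positivity

lemma rpow_mul_exp_neg_le (hα : 0 < α) (hz : 0 < z) : z ^ α * Real.exp (-z) ≤ α ^ α := by
  have hexp : z / α ≤ Real.exp (z / α) :=
    (le_add_of_nonneg_right zero_le_one).trans (Real.add_one_le_exp _)
  have hpow := Real.rpow_le_rpow (by positivity) hexp hα.le
  rw [← Real.exp_mul, div_mul_cancel₀ _ hα.ne', Real.div_rpow hz.le hα.le,
    div_le_iff₀' (by positivity)] at hpow
  rwa [Real.exp_neg, ← div_eq_mul_inv, div_le_iff₀ (Real.exp_pos _)]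

lemma norm_powGammaKernel_le (hα : 0 < α) (hA : 0 < A) (hz : 0 < z) :
    ‖powGammaKernel α A z‖ ≤ α ^ α / (A * Real.Gamma α) := by
  have h := rpow_mul_exp_neg_le hα (z := z ^ (1 / A)) (by positivity)
  rw [← Real.rpow_mul hz.le, one_div_mul_eq_div] at h
  rw [Real.norm_of_nonneg (powGammaKernel_nonneg hα hA hz), powGammaKernel]
  gcongr

@[fun_prop]
lemma measurable_powGammaKernel : Measurable (powGammaKernel α A) := by
  unfold powGammaKernel
  fun_prop

lemma continuousOn_powGammaKernel : ContinuousOn (powGammaKernel α A) (Ioi 0) := by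
  have hpow (p : ℝ) : ContinuousOn (fun z : ℝ => z ^ p) (Ioi 0) :=
    continuousOn_id.rpow_const fun z (hz : 0 < z) => .inl hz.ne'
  exact ((hpow _).mul (Real.continuous_exp.comp_continuousOn (hpow _).neg)).div_const _

end Kernel

/-- The generalized Gamma distribution, i.e. the law of `κ * G ^ A` for a Gamma variable `G` of
shape `α`. The usual parameters `(a, b, c)` are recovered with `α = a`, `κ = b`, `A = 1 / c`. -/
def genGammaMeasure (α A κ : ℝ) : Measure ℝ :=
  (gammaMeasure α 1).map fun g => κ * g ^ A

section GenGamma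

variable {α A κ : ℝ}

lemma image_div_rpow_Ioi (hA : A ≠ 0) (hκ : 0 < κ) :
    (fun z : ℝ => (z / κ) ^ (1 / A)) '' Ioi 0 = Ioi 0 := by
  refine Subset.antisymm (image_subset_iff.2 fun z (hz : 0 < z) =>
    Real.rpow_pos_of_pos (div_pos hz hκ) _) fun g (hg : 0 < g) =>
    ⟨κ * g ^ A, mul_pos hκ (Real.rpow_pos_of_pos hg A), ?_⟩
  simp only [mul_div_cancel_left₀ _ hκ.ne', one_div, Real.rpow_rpow_inv hg.le hA]

lemma injOn_div_rpow_Ioi (hA : A ≠ 0) (hκ : 0 < κ) :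
    InjOn (fun z : ℝ => (z / κ) ^ (1 / A)) (Ioi 0) := by
  intro z (hz : 0 < z) z' (hz' : 0 < z') h
  exact (div_left_inj' hκ.ne').1
    ((Real.rpow_left_inj (by positivity) (by positivity) (one_div_ne_zero hA)).1 h)

lemma hasDerivAt_div_rpow {z : ℝ} (hκ : κ ≠ 0) (hz : z ≠ 0) (p : ℝ) :
    HasDerivAt (fun z : ℝ => (z / κ) ^ p) (p * (z / κ) ^ (p - 1) / κ) z := by
  convert ((hasDerivAt_id' z).div_const κ).rpow_const (p := p) (.inl (div_ne_zero hz hκ)) using 1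
  ring

lemma jacobian_mul_gammaDensity {z : ℝ} (hA : 0 < A) (hκ : 0 < κ) (hz : 0 < z) :
    |1 / A * (z / κ) ^ (1 / A - 1) / κ| * (((z / κ) ^ (1 / A)) ^ (α - 1) *
      Real.exp (-(z / κ) ^ (1 / A)) / Real.Gamma α) = powGammaKernel α A (z / κ) / z := by
  have hq : 0 < z / κ := div_pos hz hκ
  have hpow : (z / κ) ^ (1 / A - 1) * ((z / κ) ^ (1 / A)) ^ (α - 1) =
      (z / κ) ^ (α / A) / (z / κ) := by
    rw [← Real.rpow_mul hq.le, ← Real.rpow_add hq, ← Real.rpow_sub_one hq.ne']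
    congr 1
    ring
  calc
    _ = (z / κ) ^ (1 / A - 1) * ((z / κ) ^ (1 / A)) ^ (α - 1) *
        (Real.exp (-(z / κ) ^ (1 / A)) / (A * κ * Real.Gamma α)) := by
      rw [abs_of_pos (by positivity)]
      ring
    _ = _ := by
      rw [hpow, powGammaKernel]
      field_simp

theorem genGammaMeasure_eq_withDensity (hA : 0 < A) (hκ : 0 < κ) :
    genGammaMeasure α A κ = (volume.restrict (Ioi 0)).withDensity fun z =>
      ENNReal.ofReal (powGammaKernel α A (z / κ) / z) := by
  refine Measure.ext_of_lintegral _ fun F hF => ?_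
  rw [genGammaMeasure, lintegral_map hF (by fun_prop), gammaMeasure_one_eq_withDensity,
    lintegral_withDensity_eq_lintegral_mul _ (by fun_prop) (by fun_prop),
    lintegral_withDensity_eq_lintegral_mul _ (by fun_prop) hF]
  conv_lhs => rw [← image_div_rpow_Ioi hA.ne' hκ]
  rw [lintegral_image_eq_lintegral_abs_deriv_mul measurableSet_Ioi
    (fun z (hz : 0 < z) => (hasDerivAt_div_rpow hκ.ne' hz.ne' _).hasDerivWithinAt)
    (injOn_div_rpow_Ioi hA.ne' hκ)]
  refine setLIntegral_congr_fun measurableSet_Ioi fun z (hz : 0 < z) => ?_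
  simp only [Pi.mul_apply]
  rw [← mul_assoc, ← ENNReal.ofReal_mul (abs_nonneg _), jacobian_mul_gammaDensity hA hκ hz,
    one_div, Real.rpow_inv_rpow (by positivity) hA.ne', mul_div_cancel₀ _ hκ.ne']

lemma isProbabilityMeasure_genGammaMeasure (hα : 0 < α) :
    IsProbabilityMeasure (genGammaMeasure α A κ) :=
  have := isProbabilityMeasure_gammaMeasure hα one_pos
  Measure.isProbabilityMeasure_map (by fun_prop)

theorem hasMellin_powGammaKernel {s : ℂ} (hα : 0 < α) (hA : 0 < A) (hs : 0 < α + A * s.re) :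
    HasMellin (fun z => (powGammaKernel α A z : ℂ)) s (gammaMoment α A s) := by
  have hdensity : (gammaMeasure α 1).map (fun g => g ^ A) =
      (volume.restrict (Ioi 0)).withDensity fun z =>
        ENNReal.ofReal (powGammaKernel α A z / z) := by
    simpa only [genGammaMeasure, one_mul, div_one] using
      genGammaMeasure_eq_withDensity (α := α) hA one_pos
  have hnonneg : ∀ᵐ z ∂volume.restrict (Ioi (0 : ℝ)), 0 ≤ powGammaKernel α A z / z := by
    filter_upwards [ae_restrict_mem measurableSet_Ioi] with z (hz : 0 < z)
    exact div_nonneg (powGammaKernel_nonneg hα hA hz) hz.le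
  have hsmul {z : ℝ} (hz : z ∈ Ioi 0) : (powGammaKernel α A z / z) • (z : ℂ) ^ s =
      (z : ℂ) ^ (s - 1) • (powGammaKernel α A z : ℂ) := by
    rw [Complex.cpow_sub _ _ (Complex.ofReal_ne_zero.2 (ne_of_gt hz)), Complex.cpow_one,
      Complex.real_smul, smul_eq_mul, Complex.ofReal_div]
    ring
  have hmeas : AEStronglyMeasurable (fun z : ℝ => (z : ℂ) ^ s)
      ((gammaMeasure α 1).map fun g => g ^ A) :=
    (by fun_prop : Measurable _).aestronglyMeasurable
  constructor
  · have hint := (integrable_map_measure hmeas (by fun_prop)).2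
      (integrable_rpow_cpow_gammaMeasure hα hs)
    rw [hdensity, integrable_withDensity_ofReal_iff (by fun_prop) hnonneg] at hint
    exact IntegrableOn.congr_fun hint (fun z => hsmul) measurableSet_Ioi
  · rw [← integral_rpow_cpow_gammaMeasure hα hs, mellin,
      ← setIntegral_congr_fun measurableSet_Ioi fun z => hsmul,
      ← integral_withDensity_ofReal (by fun_prop) hnonneg, ← hdensity,
      integral_map (by fun_prop) hmeas]

end GenGamma

end GammaPowers

/-! ### The H-functions as Gamma expectations -/

section FoxH

/-- The parameters of the first variable in `H_{α,A;β,B}`. -/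
def firstPar (α A : ℝ) : FoxParams := ⟨[(1 - (α : ℂ), A)], [], [], [(1, 1)]⟩

/-- The parameters of the second variable in `H_{α,A;β,B}`. -/
def secondPar (β B : ℝ) : FoxParams := ⟨[], [], [(0, 1), ((β : ℂ), B)], []⟩

lemma firstExpPar_eq (r : ℕ) : firstExpPar r = firstPar 1 r := by
  simp [firstExpPar, firstPar]

lemma secondExpPar_eq (r : ℕ) : secondExpPar r = secondPar 1 r := by
  simp [secondExpPar, secondPar]

/-- The mean of `powGammaKernel α A` at `(1 + y G ^ (-B)) / x` for a Gamma variable `G` of shape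
`β`. It is the value of `H_{α,A;β,B}(x, y) / (Γ(α) Γ(β))`. -/
def relayKernel (α A β B x y : ℝ) : ℝ :=
  ∫ g, powGammaKernel α A ((1 + g ^ (-B) * y) / x) ∂gammaMeasure β 1

variable {α A β B x y σ τ : ℝ}

lemma foxSeparates_iff : FoxSeparates jointPar (firstPar α A) (secondPar β B) σ τ ↔
    0 < σ + τ ∧ 0 < α + A * σ ∧ τ < 0 ∧ 0 < β - B * τ := by
  simp [jointPar, firstPar, secondPar, FoxSeparates, FoxParams.Separates]

lemma foxIntegrand_eq {s t : ℂ} (hα : 0 < α) (hβ : 0 < β) (ht : t.re < 0)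
    (hst : 0 < (s + t).re) :
    foxIntegrand jointPar (firstPar α A) (secondPar β B) x y s t =
      Complex.Gamma α * Complex.Gamma β * mellinBarnesIntegrand
        (gammaMoment α A) (gammaMoment β (-B)) x y s t := by
  have hΓα : Complex.Gamma α ≠ 0 := Complex.Gamma_ne_zero_of_re_pos hα
  have hΓβ : Complex.Gamma β ≠ 0 := Complex.Gamma_ne_zero_of_re_pos hβ
  rw [mellinBarnesIntegrand, Complex.betaIntegral_eq_Gamma_mul_div _ _ (by simpa) hst,
    neg_add_cancel_comm_assoc]
  simp only [foxIntegrand, gammaMoment, FoxJointParams.kernel, FoxParams.kernel, jointPar,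
    firstPar, secondPar, List.map_cons, List.map_nil, List.prod_cons, List.prod_nil,
    Complex.ofReal_one, one_mul, mul_one, div_one, sub_self, zero_add, zero_sub, sub_sub_cancel,
    Complex.ofReal_neg, neg_mul, ← sub_eq_add_neg]
  field_simp

lemma foxIntegrand_vertical_eq (hα : 0 < α) (hβ : 0 < β) (hτ : τ < 0) (hστ : 0 < σ + τ)
    (u v : ℝ) :
    foxIntegrand jointPar (firstPar α A) (secondPar β B) x y
        (σ + u * Complex.I) (τ + v * Complex.I) =
      Complex.Gamma α * Complex.Gamma β * mellinBarnesIntegrand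
        (gammaMoment α A) (gammaMoment β (-B)) x y (σ + u * Complex.I) (τ + v * Complex.I) :=
  foxIntegrand_eq hα hβ (by simpa) (by simpa)

theorem integrable_foxIntegrand (hα : 0 < α) (hA : A ≠ 0) (hβ : 0 < β) (hB : B ≠ 0) (hx : 0 < x)
    (hy : 0 < y) (h : FoxSeparates jointPar (firstPar α A) (secondPar β B) σ τ) :
    Integrable fun z : ℝ × ℝ => foxIntegrand jointPar (firstPar α A) (secondPar β B) x y
      (σ + z.1 * Complex.I) (τ + z.2 * Complex.I) := by
  obtain ⟨hστ, hασ, hτ, hβτ⟩ := foxSeparates_iff.1 h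
  simp only [foxIntegrand_vertical_eq hα hβ hτ hστ]
  exact (integrable_mellinBarnesIntegrand hτ hστ hx hy
    (verticalIntegrable_gammaMoment hA hασ)
    (verticalIntegrable_gammaMoment (neg_ne_zero.2 hB) (by linarith))).const_mul _

theorem foxContourIntegral_eq (hα : 0 < α) (hA : 0 < A) (hβ : 0 < β) (hx : 0 < x) (hy : 0 < y)
    (h : FoxSeparates jointPar (firstPar α A) (secondPar β B) σ τ) :
    foxContourIntegral jointPar (firstPar α A) (secondPar β B) x y σ τ =
      (Real.Gamma α * Real.Gamma β * relayKernel α A β B x y : ℝ) := by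
  obtain ⟨hστ, hασ, hτ, hβτ⟩ := foxSeparates_iff.1 h
  have hint : Integrable (fun g : ℝ => (g ^ (-B)) ^ τ) (gammaMeasure β 1) := by
    refine (integrable_rpow_gammaMeasure (p := -B * τ) hβ (by linarith)).congr ?_
    filter_upwards [ae_pos_gammaMeasure β] with g hg
    exact Real.rpow_mul hg.le _ _
  have := isProbabilityMeasure_gammaMeasure hβ one_pos
  have hmain := integral_integral_mellinBarnesIntegrand hτ hστ hx hy
    (fun s hs => hasMellin_powGammaKernel hα hA (hs ▸ hασ))
    (verticalIntegrable_gammaMoment hA.ne' hασ)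
    (Complex.continuous_ofReal.comp_continuousOn continuousOn_powGammaKernel)
    (by fun_prop) ((ae_pos_gammaMeasure β).mono fun g hg => Real.rpow_pos_of_pos hg (-B)) hint
    fun t ht => integral_rpow_cpow_gammaMeasure hβ (by rw [ht]; linarith)
  have hpi : (Real.pi : ℂ) ≠ 0 := Complex.ofReal_ne_zero.2 Real.pi_ne_zero
  have hI := Complex.I_ne_zero
  simp only [foxContourIntegral, foxIntegrand_vertical_eq hα hβ hτ hστ, integral_mul_const,
    integral_const_mul]
  rw [hmain, integral_complex_ofReal, ← relayKernel, Complex.Gamma_ofReal, Complex.Gamma_ofReal]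
  push_cast
  field_simp

lemma exists_foxSeparates (hα : 0 < α) (hA : 0 < A) (hβ : 0 < β) (hB : 0 < B) :
    ∃ z : ℝ × ℝ, FoxSeparates jointPar (firstPar α A) (secondPar β B) z.1 z.2 :=
  ⟨(2, -1), foxSeparates_iff.2 ⟨by norm_num, by positivity, by norm_num, by linarith⟩⟩

theorem bivariateFoxH_eq (hα : 0 < α) (hA : 0 < A) (hβ : 0 < β) (hB : 0 < B) (hx : 0 < x)
    (hy : 0 < y) : bivariateFoxH jointPar (firstPar α A) (secondPar β B) x y =
      (Real.Gamma α * Real.Gamma β * relayKernel α A β B x y : ℝ) := by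
  have hex := exists_foxSeparates hα hA hβ hB
  rw [bivariateFoxH, dif_pos hex]
  exact foxContourIntegral_eq hα hA hβ hx hy hex.choose_spec

theorem bivariateFoxHConverges (hα : 0 < α) (hA : 0 < A) (hβ : 0 < β) (hB : 0 < B) (hx : 0 < x)
    (hy : 0 < y) : BivariateFoxHConverges jointPar (firstPar α A) (secondPar β B) x y :=
  ⟨Prod.exists.1 (exists_foxSeparates hα hA hβ hB), fun _ _ h =>
    ⟨integrable_foxIntegrand hα hA.ne' hβ hB.ne' hx hy h,
      (foxContourIntegral_eq hα hA hβ hx hy h).trans (bivariateFoxH_eq hα hA hβ hB hx hy).symm⟩⟩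

section RelayKernel

lemma ae_relayKernel_arg_pos (hx : 0 < x) (hy : 0 < y) :
    ∀ᵐ g ∂gammaMeasure β 1, 0 < (1 + g ^ (-B) * y) / x := by
  filter_upwards [ae_pos_gammaMeasure β] with g hg
  positivity

lemma integrable_relayKernel (hα : 0 < α) (hA : 0 < A) (hβ : 0 < β) (hx : 0 < x) (hy : 0 < y) :
    Integrable (fun g => powGammaKernel α A ((1 + g ^ (-B) * y) / x)) (gammaMeasure β 1) := by
  have := isProbabilityMeasure_gammaMeasure hβ one_pos
  exact Integrable.of_bound (by fun_prop : Measurable _).aestronglyMeasurable _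
    ((ae_relayKernel_arg_pos hx hy).mono fun g hg => norm_powGammaKernel_le hα hA hg)

lemma relayKernel_nonneg (hα : 0 < α) (hA : 0 < A) (hx : 0 < x) (hy : 0 < y) :
    0 ≤ relayKernel α A β B x y :=
  integral_nonneg_of_ae
    ((ae_relayKernel_arg_pos hx hy).mono fun _ hg => powGammaKernel_nonneg hα hA hg)

lemma measurable_relayKernel (hβ : 0 < β) : Measurable fun x => relayKernel α A β B x y := by
  have := isProbabilityMeasure_gammaMeasure hβ one_pos
  exact (StronglyMeasurable.integral_prod_right'
    (f := fun p : ℝ × ℝ => powGammaKernel α A ((1 + p.2 ^ (-B) * y) / p.1))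
    (by fun_prop : Measurable _).stronglyMeasurable).measurable

theorem continuousOn_relayKernel (hα : 0 < α) (hA : 0 < A) (hβ : 0 < β) (hy : 0 < y) :
    ContinuousOn (fun x => relayKernel α A β B x y) (Ioi 0) := by
  have := isProbabilityMeasure_gammaMeasure hβ one_pos
  refine continuousOn_of_dominated (bound := fun _ => α ^ α / (A * Real.Gamma α))
    (fun x _ => (by fun_prop : Measurable _).aestronglyMeasurable)
    (fun x hx => (ae_relayKernel_arg_pos hx hy).mono fun g => norm_powGammaKernel_le hα hA)
    (integrable_const _) ?_
  filter_upwards [ae_pos_gammaMeasure β] with g hg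
  exact continuousOn_powGammaKernel.comp
    (continuousOn_const.div continuousOn_id fun x hx => ne_of_gt hx)
    fun x (hx : 0 < x) => mem_Ioi.2 (by positivity)

end RelayKernel

end FoxH

/-! ### Generalized Gamma mixtures -/

section GenGammaMoments

variable {α A κ : ℝ}

lemma map_mul_const_genGammaMeasure (q : ℝ) :
    (genGammaMeasure α A κ).map (fun x => x * q) = genGammaMeasure α A (κ * q) := by
  rw [genGammaMeasure, Measure.map_map (by fun_prop) (by fun_prop)]
  exact congrArg (Measure.map · _) (funext fun g => mul_right_comm _ _ _)

lemma mul_rpow_pow {g : ℝ} (hg : 0 ≤ g) (n : ℕ) :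
    (κ * g ^ A) ^ n = κ ^ n * g ^ (n * A) := by
  rw [mul_pow, ← Real.rpow_natCast (g ^ A), ← Real.rpow_mul hg, mul_comm A]

lemma map_const_mul_pow_genGammaMeasure (c : ℝ) (n : ℕ) :
    (genGammaMeasure α A κ).map (fun x => c * x ^ n) =
      genGammaMeasure α (n * A) (κ ^ n * c) := by
  rw [genGammaMeasure, Measure.map_map (by fun_prop) (by fun_prop)]
  refine Measure.map_congr ((ae_pos_gammaMeasure α).mono fun g hg => ?_)
  simp only [Function.comp_apply, mul_rpow_pow hg.le]
  ring

lemma ae_pow_eq_gammaMeasure (n : ℕ) :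
    (fun g => (κ * g ^ A) ^ n) =ᵐ[gammaMeasure α 1] fun g => κ ^ n * g ^ (n * A) :=
  (ae_pos_gammaMeasure α).mono fun _ hg => mul_rpow_pow hg.le n

lemma integrable_pow_genGammaMeasure (hα : 0 < α) (hA : 0 ≤ A) (n : ℕ) :
    Integrable (fun x => x ^ n) (genGammaMeasure α A κ) := by
  rw [genGammaMeasure, integrable_map_measure (by fun_prop) (by fun_prop)]
  exact ((integrable_rpow_gammaMeasure hα (by positivity)).const_mul _).congr
    (ae_pow_eq_gammaMeasure n).symm

lemma integral_pow_genGammaMeasure (hα : 0 < α) (hA : 0 ≤ A) (n : ℕ) :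
    ∫ x, x ^ n ∂genGammaMeasure α A κ =
      κ ^ n * (Real.Gamma (α + n * A) / Real.Gamma α) := by
  rw [genGammaMeasure, integral_map (by fun_prop) (by fun_prop),
    integral_congr_ae (ae_pow_eq_gammaMeasure n), integral_const_mul,
    integral_rpow_gammaMeasure hα (by positivity)]

end GenGammaMoments

section Mixture

lemma sum_smul_withDensity_ofReal {ι X : Type*} [Fintype ι] [MeasurableSpace X] {ν : Measure X}
    {w : ι → ℝ} {f : ι → X → ℝ} (hw : ∀ i, 0 ≤ w i) (hf : ∀ i, Measurable (f i))
    (hf0 : ∀ i, ∀ᵐ x ∂ν, 0 ≤ f i x) :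
    ∑ i, ENNReal.ofReal (w i) • ν.withDensity (fun x => ENNReal.ofReal (f i x)) =
      ν.withDensity fun x => ENNReal.ofReal (∑ i, w i * f i x) := by
  simp only [← withDensity_smul _ (hf _).ennreal_ofReal]
  rw [← Measure.sum_fintype,
    ← withDensity_tsum fun i => (hf i).ennreal_ofReal.const_smul (ENNReal.ofReal (w i))]
  refine withDensity_congr_ae ?_
  filter_upwards [ae_all_iff.2 hf0] with x hx
  rw [tsum_fintype, ENNReal.ofReal_sum_of_nonneg fun i _ => mul_nonneg (hw i) (hx i)]
  simp only [Finset.sum_apply, Pi.smul_apply, smul_eq_mul, ENNReal.ofReal_mul (hw _)]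

/-- A mixture of generalized Gamma distributions: with weight `weight i`, the distribution
`genGammaMeasure (shape i) (exponent i) (scale i)`. The weights need not add up to `1`. -/
structure GenGammaMixture (ι : Type*) where
  weight : ι → ℝ
  shape : ι → ℝ
  exponent : ι → ℝ
  scale : ι → ℝ
  weight_nonneg : ∀ i, 0 ≤ weight i
  shape_pos : ∀ i, 0 < shape i
  exponent_pos : ∀ i, 0 < exponent i
  scale_pos : ∀ i, 0 < scale i

namespace GenGammaMixture

variable {ι κ : Type*} (m : GenGammaMixture ι) (n : GenGammaMixture κ)

/-- The `i`-th component of a generalized Gamma mixture. -/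
def component (i : ι) : Measure ℝ :=
  genGammaMeasure (m.shape i) (m.exponent i) (m.scale i)

instance (i : ι) : IsProbabilityMeasure (m.component i) :=
  isProbabilityMeasure_genGammaMeasure (m.shape_pos i)

/-- The mixture followed by `c * X ^ r` when `X` follows the mixture `m`. -/
@[simps]
def constMulPow {c : ℝ} (hc : 0 < c) {r : ℕ} (hr : 0 < r) : GenGammaMixture ι where
  weight := m.weight
  shape := m.shape
  exponent i := r * m.exponent i
  scale i := m.scale i ^ r * c
  weight_nonneg := m.weight_nonneg
  shape_pos := m.shape_pos
  exponent_pos i := mul_pos (Nat.cast_pos.2 hr) (m.exponent_pos i)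
  scale_pos i := mul_pos (pow_pos (m.scale_pos i) r) hc

variable [Fintype ι] [Fintype κ]

/-- The distribution of a generalized Gamma mixture. -/
protected def measure : Measure ℝ :=
  ∑ i, ENNReal.ofReal (m.weight i) • m.component i

instance : IsFiniteMeasure m.measure := by
  have (i : ι) := (m.component i).smul_finite (ENNReal.ofReal_ne_top (r := m.weight i))
  unfold GenGammaMixture.measure
  infer_instance

lemma measure_constMulPow {c : ℝ} (hc : 0 < c) {r : ℕ} (hr : 0 < r) :
    (m.constMulPow hc hr).measure = m.measure.map fun x => c * x ^ r := by
  simp only [GenGammaMixture.measure, component]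
  rw [Measure.map_finset_sum' (by fun_prop)]
  simp only [Measure.map_smul, map_const_mul_pow_genGammaMeasure, constMulPow_weight,
    constMulPow_shape, constMulPow_exponent, constMulPow_scale]

lemma integral_pow_measure (k : ℕ) :
    ∫ x, x ^ k ∂m.measure = ∑ i, m.weight i *
      (m.scale i ^ k * (Real.Gamma (m.shape i + k * m.exponent i) / Real.Gamma (m.shape i))) := by
  have hint (i : ι) : Integrable (fun x => x ^ k) (m.component i) :=
    integrable_pow_genGammaMeasure (m.shape_pos i) (m.exponent_pos i).le k
  rw [GenGammaMixture.measure,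
    integral_finsetSum_measure fun i _ => (hint i).smul_measure ENNReal.ofReal_ne_top]
  refine Finset.sum_congr rfl fun i _ => ?_
  rw [integral_smul_measure, component,
    integral_pow_genGammaMeasure (m.shape_pos i) (m.exponent_pos i).le,
    ENNReal.toReal_ofReal (m.weight_nonneg i), smul_eq_mul]

lemma measure_eq_withDensity : m.measure = (volume.restrict (Ioi 0)).withDensity fun x =>
    ENNReal.ofReal (∑ i, m.weight i *
      (powGammaKernel (m.shape i) (m.exponent i) (x / m.scale i) / x)) := by
  have hnonneg (i : ι) : ∀ᵐ x ∂volume.restrict (Ioi (0 : ℝ)),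
      0 ≤ powGammaKernel (m.shape i) (m.exponent i) (x / m.scale i) / x := by
    filter_upwards [ae_restrict_mem measurableSet_Ioi] with x (hx : 0 < x)
    exact div_nonneg (powGammaKernel_nonneg (m.shape_pos i) (m.exponent_pos i)
      (div_pos hx (m.scale_pos i))) hx.le
  rw [← sum_smul_withDensity_ofReal m.weight_nonneg (fun i => by fun_prop) hnonneg]
  simp only [GenGammaMixture.measure, component,
    genGammaMeasure_eq_withDensity (m.exponent_pos _) (m.scale_pos _)]

lemma map_measure_prod_measure {T : ℝ × ℝ → ℝ} (hT : Measurable T) :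
    (m.measure.prod n.measure).map T = ∑ k : ι × κ, ENNReal.ofReal (m.weight k.1 * n.weight k.2) •
      ((m.component k.1).prod (n.component k.2)).map T := by
  simp only [GenGammaMixture.measure, ← Measure.sum_fintype]
  rw [Measure.prod_sum, Measure.map_sum hT.aemeasurable]
  simp only [Measure.prod_smul_left, Measure.prod_smul_right, Measure.map_smul, smul_smul,
    mul_comm (m.weight _), ENNReal.ofReal_mul (n.weight_nonneg _)]

end GenGammaMixture

namespace EGGParams

variable (p : EGGParams)

/-- The EGG distribution as a mixture: an exponential variable is a Gamma variable of shape `1`. -/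
@[simps]
def mixture : GenGammaMixture (Fin 2) where
  weight := ![p.ω, 1 - p.ω]
  shape := ![1, p.a]
  exponent := ![1, 1 / p.c]
  scale := ![p.lam, p.b]
  weight_nonneg := Fin.forall_fin_two.2 ⟨p.ω_pos.le, sub_nonneg.2 p.ω_lt_one.le⟩
  shape_pos := Fin.forall_fin_two.2 ⟨one_pos, p.a_pos⟩
  exponent_pos := Fin.forall_fin_two.2 ⟨one_pos, one_div_pos.2 p.c_pos⟩
  scale_pos := Fin.forall_fin_two.2 ⟨p.lam_pos, p.b_pos⟩

lemma eggPDF_eq {x : ℝ} (hx : 0 < x) :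
    eggPDF p x = p.ω * (powGammaKernel 1 1 (x / p.lam) / x) +
      (1 - p.ω) * (powGammaKernel p.a (1 / p.c) (x / p.b) / x) := by
  have hl := p.lam_pos
  have hb := p.b_pos
  have hG := Real.Gamma_pos_of_pos p.a_pos
  have hpow : (x / p.b) ^ (p.a / (1 / p.c)) = x ^ (p.a * p.c) / p.b ^ (p.a * p.c) := by
    rw [div_div_eq_mul_div, div_one, Real.div_rpow hx.le hb.le]
  rw [eggPDF, if_pos hx, powGammaKernel, powGammaKernel, div_self one_ne_zero, Real.rpow_one,
    Real.Gamma_one, one_div_one_div, hpow, Real.rpow_sub_one hx.ne']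
  field_simp

theorem eggMeasure_eq : eggMeasure p = p.mixture.measure := by
  rw [GenGammaMixture.measure_eq_withDensity, eggMeasure, ← withDensity_indicator measurableSet_Ioi]
  congr 1 with x
  obtain hx | hx := lt_or_ge 0 x
  · simp [indicator_of_mem (mem_Ioi.2 hx), p.eggPDF_eq hx]
  · simp [eggPDF, hx.not_gt]

theorem integral_sq_eggMeasure : ∫ x, x ^ 2 ∂eggMeasure p = 2 * p.ω * p.lam ^ 2 +
    p.b ^ 2 * (1 - p.ω) * Real.Gamma (p.a + 2 / p.c) / Real.Gamma p.a := by
  have hΓ : Real.Gamma (1 + 2) = 2 := by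
    simpa [add_comm] using Real.Gamma_nat_eq_factorial 2
  rw [eggMeasure_eq, GenGammaMixture.integral_pow_measure]
  simp only [mixture_weight, mixture_scale, mixture_shape, mixture_exponent, Nat.cast_ofNat,
    div_eq_mul_inv, one_mul, mul_one, inv_one, Fin.sum_univ_two, Matrix.cons_val_zero,
    Matrix.cons_val_one, hΓ, Real.Gamma_one]
  ring

end EGGParams

end Mixture

/-! ### The law of the end-to-end SNR -/

section RelayLaw

lemma map_prod_eq_withDensity {X Y Z : Type*} [MeasurableSpace X] [MeasurableSpace Y]
    [MeasurableSpace Z] {μ : Measure X} {ρ : Measure Y} {ν : Measure Z} [SFinite μ] [SFinite ρ]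
    [SFinite ν] {T : X × Y → Z} {p : Y → Z → ℝ≥0∞} (hT : Measurable T)
    (hp : Measurable (Function.uncurry p))
    (hmap : ∀ᵐ y ∂ρ, μ.map (fun x => T (x, y)) = ν.withDensity (p y)) :
    (μ.prod ρ).map T = ν.withDensity fun z => ∫⁻ y, p y z ∂ρ := by
  refine Measure.ext_of_lintegral _ fun F hF => ?_
  have hconditional : ∀ᵐ y ∂ρ, ∫⁻ x, F (T (x, y)) ∂μ = ∫⁻ z, p y z * F z ∂ν := by
    filter_upwards [hmap] with y hy
    rw [← lintegral_map hF (by fun_prop : Measurable fun x => T (x, y)), hy,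
      lintegral_withDensity_eq_lintegral_mul _ hp.of_uncurry_left hF]
    rfl
  rw [lintegral_map hF hT, lintegral_prod_symm (fun q => F (T q)) (hF.comp hT).aemeasurable,
    lintegral_congr_ae hconditional,
    lintegral_lintegral_swap (hp.mul (hF.comp measurable_snd)).aemeasurable,
    lintegral_withDensity_eq_lintegral_mul _ hp.lintegral_prod_left hF]
  exact lintegral_congr fun z => lintegral_mul_const _ hp.of_uncurry_right

/-- The end-to-end SNR as a function of the pair of SNRs of the hops. -/
def relaySNR (C : ℝ) (p : ℝ × ℝ) : ℝ :=
  p.1 * p.2 / (p.2 + C)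

@[fun_prop]
lemma measurable_relaySNR {C : ℝ} : Measurable (relaySNR C) := by
  unfold relaySNR
  fun_prop

variable {α A β B K L C : ℝ}

lemma map_relaySNR_genGammaMeasure_left {g : ℝ} (hA : 0 < A) (hK : 0 < K) (hL : 0 < L)
    (hC : 0 < C) (hg : 0 < g) :
    (genGammaMeasure α A K).map (fun x => relaySNR C (x, L * g ^ B)) =
      (volume.restrict (Ioi 0)).withDensity fun z =>
        ENNReal.ofReal (powGammaKernel α A ((1 + g ^ (-B) * (C / L)) / (K / z)) / z) := by
  have hscale (x : ℝ) : relaySNR C (x, L * g ^ B) = x * (1 + g ^ (-B) * (C / L))⁻¹ := by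
    rw [relaySNR, Real.rpow_neg hg.le]
    field_simp
  have harg (z : ℝ) : z / (K * (1 + g ^ (-B) * (C / L))⁻¹) =
      (1 + g ^ (-B) * (C / L)) / (K / z) := by
    rw [div_mul_eq_div_div, div_inv_eq_mul, div_div_eq_mul_div]
    ring
  simp only [hscale, map_mul_const_genGammaMeasure]
  rw [genGammaMeasure_eq_withDensity hA (by positivity)]
  simp only [harg]

theorem map_relaySNR_genGammaMeasure (hα : 0 < α) (hA : 0 < A) (hβ : 0 < β) (hK : 0 < K)
    (hL : 0 < L) (hC : 0 < C) :
    ((genGammaMeasure α A K).prod (genGammaMeasure β B L)).map (relaySNR C) =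
      (volume.restrict (Ioi 0)).withDensity fun z =>
        ENNReal.ofReal (relayKernel α A β B (K / z) (C / L) / z) := by
  have := isProbabilityMeasure_gammaMeasure hβ one_pos
  have := isProbabilityMeasure_genGammaMeasure (A := A) (κ := K) hα
  have hprod : (genGammaMeasure α A K).prod (genGammaMeasure β B L) =
      ((genGammaMeasure α A K).prod (gammaMeasure β 1)).map
        (Prod.map id fun g => L * g ^ B) := by
    rw [← Measure.map_prod_map _ _ measurable_id (by fun_prop), Measure.map_id,
      ← genGammaMeasure]
  rw [hprod, Measure.map_map (by fun_prop) (by fun_prop), map_prod_eq_withDensity (by fun_prop)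
    (by fun_prop) ((ae_pos_gammaMeasure β).mono fun g hg =>
      map_relaySNR_genGammaMeasure_left hA hK hL hC hg)]
  refine withDensity_congr_ae ?_
  filter_upwards [ae_restrict_mem measurableSet_Ioi] with z (hz : 0 < z)
  have hx : 0 < K / z := div_pos hK hz
  have hy : 0 < C / L := div_pos hC hL
  rw [relayKernel, ← integral_div, ofReal_integral_eq_lintegral_ofReal
    ((integrable_relayKernel hα hA hβ hx hy).div_const z)]
  exact (ae_relayKernel_arg_pos hx hy).mono fun g hg =>
    div_nonneg (powGammaKernel_nonneg hα hA hg) hz.le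

end RelayLaw

section RelayPDF

variable {ι κ : Type*} (m : GenGammaMixture ι) (n : GenGammaMixture κ) {C : ℝ} (k : ι × κ)

/-- The density on the positive half-line of `X * Y / (Y + C)` for independent `X` and `Y` whose
distributions are the components `k.1` of `m` and `k.2` of `n`. -/
def relayComponentPDF (C : ℝ) (z : ℝ) : ℝ :=
  relayKernel (m.shape k.1) (m.exponent k.1) (n.shape k.2) (n.exponent k.2)
    (m.scale k.1 / z) (C / n.scale k.2) / z

lemma relayComponentPDF_nonneg (hC : 0 < C) {z : ℝ} (hz : 0 < z) :
    0 ≤ relayComponentPDF m n k C z :=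
  div_nonneg (relayKernel_nonneg (m.shape_pos _) (m.exponent_pos _) (div_pos (m.scale_pos _) hz)
    (div_pos hC (n.scale_pos _))) hz.le

lemma measurable_relayComponentPDF : Measurable (relayComponentPDF m n k C) :=
  ((measurable_relayKernel (n.shape_pos _)).comp (measurable_const.div measurable_id)).div
    measurable_id

lemma continuousOn_relayComponentPDF (hC : 0 < C) :
    ContinuousOn (relayComponentPDF m n k C) (Ioi 0) :=
  have hne : ∀ z ∈ Ioi (0 : ℝ), id z ≠ 0 := fun _ hz => ne_of_gt hz
  ((continuousOn_relayKernel (m.shape_pos _) (m.exponent_pos _) (n.shape_pos _)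
    (div_pos hC (n.scale_pos _))).comp (continuousOn_const.div continuousOn_id hne)
    fun _ hz => div_pos (m.scale_pos _) hz).div continuousOn_id hne

variable [Fintype ι] [Fintype κ]

/-- The density of `X * Y / (Y + C)` for independent `X` and `Y` following the mixtures `m` and
`n`. -/
def relayPDF (C : ℝ) : ℝ → ℝ :=
  (Ioi 0).indicator fun z => ∑ k : ι × κ, m.weight k.1 * n.weight k.2 * relayComponentPDF m n k C z

lemma relayPDF_nonneg (hC : 0 < C) (x : ℝ) : 0 ≤ relayPDF m n C x :=
  indicator_nonneg (fun z (hz : z ∈ Ioi 0) => Finset.sum_nonneg fun k _ =>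
    mul_nonneg (mul_nonneg (m.weight_nonneg _) (n.weight_nonneg _))
      (relayComponentPDF_nonneg m n k hC hz)) x

lemma measurable_relayPDF : Measurable (relayPDF m n C) :=
  (Finset.measurable_fun_sum _ fun k _ =>
    (measurable_relayComponentPDF m n k).const_mul _).indicator measurableSet_Ioi

lemma continuousOn_relayPDF (hC : 0 < C) : ContinuousOn (relayPDF m n C) (Ioi 0) :=
  (continuousOn_finsetSum _ fun k _ => continuousOn_const.mul
    (continuousOn_relayComponentPDF m n k hC)).congr eqOn_indicator

theorem map_relaySNR_measure (hC : 0 < C) : (m.measure.prod n.measure).map (relaySNR C) =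
    volume.withDensity fun z => ENNReal.ofReal (relayPDF m n C z) := by
  have hindicator : (fun z => ENNReal.ofReal (relayPDF m n C z)) = (Ioi 0).indicator fun z =>
      ENNReal.ofReal (∑ k, m.weight k.1 * n.weight k.2 * relayComponentPDF m n k C z) :=
    (indicator_comp_of_zero ENNReal.ofReal_zero).symm
  have hnonneg (k : ι × κ) :
      ∀ᵐ z ∂volume.restrict (Ioi 0), 0 ≤ relayComponentPDF m n k C z :=
    (ae_restrict_mem measurableSet_Ioi).mono fun _ hz => relayComponentPDF_nonneg m n k hC hz
  rw [hindicator, withDensity_indicator measurableSet_Ioi, ← sum_smul_withDensity_ofReal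
    (fun k => mul_nonneg (m.weight_nonneg k.1) (n.weight_nonneg k.2))
    (measurable_relayComponentPDF m n) hnonneg, m.map_measure_prod_measure n (by fun_prop)]
  simp only [GenGammaMixture.component, map_relaySNR_genGammaMeasure (m.shape_pos _)
    (m.exponent_pos _) (n.shape_pos _) (m.scale_pos _) (n.scale_pos _) hC, relayComponentPDF]

end RelayPDF

section EndToEnd

lemma hopSNR_eq {Ω : Type*} (η N : ℝ) (r : ℕ) (I : Ω → ℝ) :
    hopSNR η N r I = fun w => avgElectricalSNR η N r * I w ^ r := by
  funext w
  rw [hopSNR, avgElectricalSNR, mul_pow, mul_div_right_comm]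

lemma avgElectricalSNR_pos {η N : ℝ} (hη : 0 < η) (hN : 0 < N) (r : ℕ) :
    0 < avgElectricalSNR η N r :=
  div_pos (pow_pos hη r) hN

lemma EGGParams.sq_moment_pos (p : EGGParams) : 0 < 2 * p.ω * p.lam ^ 2 +
    p.b ^ 2 * (1 - p.ω) * Real.Gamma (p.a + 2 / p.c) / Real.Gamma p.a := by
  have hω : 0 < 1 - p.ω := sub_pos.2 p.ω_lt_one
  have := p.ω_pos
  have := p.lam_pos
  have := p.a_pos
  have := p.b_pos
  have := p.c_pos
  positivity

variable {Ω : Type*} [MeasurableSpace Ω] {P : Measure Ω} {p : EGGParams} {η N : ℝ} {r : ℕ}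
  {I : Ω → ℝ}

theorem avgElectricalSNRSpec_hopSNR (hI : HasLaw I (eggMeasure p) P) :
    AvgElectricalSNRSpec P p r I (hopSNR η N r I) (avgElectricalSNR η N r) := by
  rw [hopSNR_eq]
  refine ⟨?_, ?_⟩
  · rintro rfl hmean
    simp only [pow_one, integral_const_mul, hmean, mul_one]
  · rintro rfl
    have hsq : ∫ w, I w ^ 2 ∂P = ∫ x, x ^ 2 ∂eggMeasure p :=
      hI.integral_comp (f := fun x : ℝ => x ^ 2) (by fun_prop)
    rw [integral_const_mul, hsq, p.integral_sq_eggMeasure, mul_div_cancel_right₀ _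
      p.sq_moment_pos.ne']

lemma hasLaw_hopSNR (hη : 0 < η) (hN : 0 < N) (hr : 0 < r) (hI : HasLaw I (eggMeasure p) P) :
    HasLaw (hopSNR η N r I)
      (p.mixture.constMulPow (avgElectricalSNR_pos hη hN r) hr).measure P := by
  rw [hopSNR_eq, GenGammaMixture.measure_constMulPow, ← p.eggMeasure_eq]
  exact HasLaw.fun_comp (Y := fun x : ℝ => avgElectricalSNR η N r * x ^ r)
    ⟨by fun_prop, rfl⟩ hI

lemma indepFun_hopSNR {η' N' : ℝ} {r' : ℕ} {I' : Ω → ℝ} (h : IndepFun I I' P) :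
    IndepFun (hopSNR η N r I) (hopSNR η' N' r' I') P :=
  h.comp (φ := fun x => (η * x) ^ r / N) (ψ := fun x => (η' * x) ^ r' / N') (by fun_prop)
    (by fun_prop)

theorem hasLaw_endToEndSNR {ι κ : Type*} [Fintype ι] [Fintype κ] {m : GenGammaMixture ι}
    {n : GenGammaMixture κ} {C : ℝ} {X Y : Ω → ℝ} (hC : 0 < C) (hX : HasLaw X m.measure P)
    (hY : HasLaw Y n.measure P) (hXY : IndepFun X Y P) :
    HasLaw (endToEndSNR C X Y)
      (volume.withDensity fun z => ENNReal.ofReal (relayPDF m n C z)) P :=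
  have := hX.isFiniteMeasure
  HasLaw.fun_comp (Y := relaySNR C) ⟨by fun_prop, map_relaySNR_measure m n hC⟩
    (hXY.hasLaw_prod hX hY)

lemma hasDerivAt_measureReal_Iic_withDensity {f : ℝ → ℝ} (hf : Measurable f) (hf0 : ∀ x, 0 ≤ f x)
    [IsFiniteMeasure (volume.withDensity fun x => ENNReal.ofReal (f x))] {x : ℝ}
    (hx : ContinuousAt f x) :
    HasDerivAt (fun y => (volume.withDensity fun x => ENNReal.ofReal (f x)).real (Iic y))
      (f x) x := by
  have hint : Integrable f := by
    refine ⟨hf.aestronglyMeasurable, ?_⟩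
    rw [hasFiniteIntegral_iff_ofReal (.of_forall hf0), ← setLIntegral_univ,
      ← withDensity_apply _ .univ]
    exact measure_lt_top _ _
  have hcdf (y : ℝ) : (volume.withDensity fun x => ENNReal.ofReal (f x)).real (Iic y) =
      (∫ z in Iic x, f z) + ∫ z in x..y, f z := by
    rw [← intervalIntegral.integral_Iic_sub_Iic hint.integrableOn hint.integrableOn,
      add_sub_cancel, measureReal_def, withDensity_apply _ measurableSet_Iic,
      ← ofReal_integral_eq_lintegral_ofReal hint.integrableOn (.of_forall hf0),
      ENNReal.toReal_ofReal (setIntegral_nonneg measurableSet_Iic fun z _ => hf0 z)]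
  simp only [hcdf]
  exact (intervalIntegral.integral_hasDerivAt_right .refl
    hf.stronglyMeasurable.stronglyMeasurableAtFilter hx).const_add _

lemma hasDerivAt_measureReal_le [IsFiniteMeasure P] {f : ℝ → ℝ} (hf : Measurable f)
    (hf0 : ∀ x, 0 ≤ f x) {X : Ω → ℝ}
    (hX : HasLaw X (volume.withDensity fun x => ENNReal.ofReal (f x)) P) {x : ℝ}
    (hx : ContinuousAt f x) : HasDerivAt (fun y => P.real {w | X w ≤ y}) (f x) x := by
  have := hX.isFiniteMeasure_iff.1 inferInstance
  have hcdf (y : ℝ) : P.real {w | X w ≤ y} =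
      (volume.withDensity fun x => ENNReal.ofReal (f x)).real (Iic y) :=
    hX.measureReal_eq (p := fun x => x ≤ y) measurableSet_Iic
  simpa only [hcdf] using hasDerivAt_measureReal_Iic_withDensity hf hf0 hx

end EndToEnd

section Density

variable {p₁ p₂ : EGGParams} {r₁ r₂ : ℕ} {μ₁ μ₂ C x : ℝ}

theorem endToEndSNRDensity_converges (hr₁ : 0 < r₁) (hr₂ : 0 < r₂) (hμ₁ : 0 < μ₁) (hμ₂ : 0 < μ₂)
    (hC : 0 < C) (hx : 0 < x) : EndToEndSNRDensityConverges p₁ p₂ r₁ r₂ μ₁ μ₂ C x := by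
  have := p₁.lam_pos
  have ha₁ := p₁.a_pos
  have := p₁.b_pos
  have := p₁.c_pos
  have := p₂.lam_pos
  have ha₂ := p₂.a_pos
  have := p₂.b_pos
  have := p₂.c_pos
  rw [EndToEndSNRDensityConverges, firstExpPar_eq, secondExpPar_eq]
  refine ⟨bivariateFoxHConverges one_pos ?_ one_pos ?_ ?_ ?_,
    bivariateFoxHConverges one_pos ?_ ha₂ ?_ ?_ ?_,
    bivariateFoxHConverges ha₁ ?_ one_pos ?_ ?_ ?_,
    bivariateFoxHConverges ha₁ ?_ ha₂ ?_ ?_ ?_⟩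
  all_goals positivity

theorem relayPDF_mixture (hr₁ : 0 < r₁) (hr₂ : 0 < r₂) (hμ₁ : 0 < μ₁) (hμ₂ : 0 < μ₂)
    (hC : 0 < C) (hx : 0 < x) :
    (relayPDF (p₁.mixture.constMulPow hμ₁ hr₁) (p₂.mixture.constMulPow hμ₂ hr₂) C x : ℂ) =
      endToEndSNRDensity p₁ p₂ r₁ r₂ μ₁ μ₂ C x := by
  have := p₁.lam_pos
  have ha₁ := p₁.a_pos
  have := p₁.b_pos
  have := p₁.c_pos
  have := p₂.lam_pos
  have ha₂ := p₂.a_pos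
  have := p₂.b_pos
  have := p₂.c_pos
  have := Real.Gamma_pos_of_pos ha₁
  have := Real.Gamma_pos_of_pos ha₂
  have hfirst : firstGGPar p₁ r₁ = firstPar p₁.a (r₁ / p₁.c) := rfl
  have hsecond : secondGGPar p₂ r₂ = secondPar p₂.a (r₂ / p₂.c) := rfl
  rw [relayPDF, indicator_of_mem (mem_Ioi.2 hx), endToEndSNRDensity, firstExpPar_eq,
    secondExpPar_eq, hfirst, hsecond]
  rw [bivariateFoxH_eq one_pos (by positivity) one_pos (by positivity) (by positivity)
      (by positivity),
    bivariateFoxH_eq one_pos (by positivity) ha₂ (by positivity) (by positivity) (by positivity),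
    bivariateFoxH_eq ha₁ (by positivity) one_pos (by positivity) (by positivity) (by positivity),
    bivariateFoxH_eq ha₁ (by positivity) ha₂ (by positivity) (by positivity) (by positivity)]
  norm_cast
  simp only [relayComponentPDF, Fintype.sum_prod_type, Fin.sum_univ_two,
    GenGammaMixture.constMulPow_weight, GenGammaMixture.constMulPow_shape,
    GenGammaMixture.constMulPow_exponent, GenGammaMixture.constMulPow_scale,
    EGGParams.mixture_weight, EGGParams.mixture_shape, EGGParams.mixture_exponent,
    EGGParams.mixture_scale, Matrix.cons_val_zero, Matrix.cons_val_one, mul_one, mul_one_div,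
    Real.Gamma_one]
  field_simp
  ring

end Density

theorem theorem2_general {Ω : Type*} [MeasurableSpace Ω] (P : Measure Ω)
    (p₁ p₂ : EGGParams) (r₁ r₂ : ℕ) (hr₁ : 0 < r₁) (hr₂ : 0 < r₂)
    (η N₁ N₂ C : ℝ) (hη : 0 < η) (hN₁ : 0 < N₁) (hN₂ : 0 < N₂) (hC : 0 < C)
    (I₁ I₂ : Ω → ℝ) (hI₁ : HasLaw I₁ (eggMeasure p₁) P) (hI₂ : HasLaw I₂ (eggMeasure p₂) P)
    (hI : IndepFun I₁ I₂ P) :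
    let γ₁ := hopSNR η N₁ r₁ I₁
    let γ₂ := hopSNR η N₂ r₂ I₂
    let γ := endToEndSNR C γ₁ γ₂
    let μ₁ := avgElectricalSNR η N₁ r₁
    let μ₂ := avgElectricalSNR η N₂ r₂
    AvgElectricalSNRSpec P p₁ r₁ I₁ γ₁ μ₁ ∧ AvgElectricalSNRSpec P p₂ r₂ I₂ γ₂ μ₂ ∧
    (∀ x : ℝ, 0 < x → EndToEndSNRDensityConverges p₁ p₂ r₁ r₂ μ₁ μ₂ C x) ∧
    ∃ f : ℝ → ℝ, Measurable f ∧ (∀ x, 0 ≤ f x) ∧ (∀ x, x ≤ 0 → f x = 0) ∧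
      (∀ x, 0 < x → (f x : ℂ) = endToEndSNRDensity p₁ p₂ r₁ r₂ μ₁ μ₂ C x) ∧
      HasLaw γ (volume.withDensity fun x => ENNReal.ofReal (f x)) P ∧
      ∀ x, 0 < x → HasDerivAt (fun y => P.real {w | γ w ≤ y}) (f x) x := by
  intro γ₁ γ₂ γ μ₁ μ₂
  have hμ₁ : 0 < μ₁ := avgElectricalSNR_pos hη hN₁ r₁
  have hμ₂ : 0 < μ₂ := avgElectricalSNR_pos hη hN₂ r₂
  let m := p₁.mixture.constMulPow hμ₁ hr₁
  let n := p₂.mixture.constMulPow hμ₂ hr₂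
  have hγ₁ : HasLaw γ₁ m.measure P := hasLaw_hopSNR hη hN₁ hr₁ hI₁
  have hγ₂ : HasLaw γ₂ n.measure P := hasLaw_hopSNR hη hN₂ hr₂ hI₂
  have hγ := hasLaw_endToEndSNR hC hγ₁ hγ₂ (indepFun_hopSNR hI)
  have := hγ₁.isFiniteMeasure
  exact ⟨avgElectricalSNRSpec_hopSNR hI₁, avgElectricalSNRSpec_hopSNR hI₂,
    fun x hx => endToEndSNRDensity_converges hr₁ hr₂ hμ₁ hμ₂ hC hx, relayPDF m n C,
    measurable_relayPDF m n, relayPDF_nonneg m n hC,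
    fun x hx => indicator_of_notMem (notMem_Ioi.2 hx) _,
    fun x hx => relayPDF_mixture hr₁ hr₂ hμ₁ hμ₂ hC hx, hγ,
    fun x hx => hasDerivAt_measureReal_le (measurable_relayPDF m n) (relayPDF_nonneg m n hC) hγ
      ((continuousOn_relayPDF m n hC).continuousAt (Ioi_mem_nhds hx))⟩

end

theorem theorem2 {Ω : Type*} [MeasurableSpace Ω] (P : Measure Ω) [IsProbabilityMeasure P]
    (p₁ p₂ : EGGParams) (r₁ r₂ : ℕ) (hr₁ : r₁ = 1 ∨ r₁ = 2) (hr₂ : r₂ = 1 ∨ r₂ = 2)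
    (η N₁ N₂ C : ℝ) (hη : 0 < η) (hN₁ : 0 < N₁) (hN₂ : 0 < N₂) (hC : 0 < C)
    (I₁ I₂ : Ω → ℝ) (hI₁ : HasLaw I₁ (eggMeasure p₁) P) (hI₂ : HasLaw I₂ (eggMeasure p₂) P)
    (hI : IndepFun I₁ I₂ P) :
    let γ₁ := hopSNR η N₁ r₁ I₁
    let γ₂ := hopSNR η N₂ r₂ I₂
    let γ := endToEndSNR C γ₁ γ₂
    let μ₁ := avgElectricalSNR η N₁ r₁
    let μ₂ := avgElectricalSNR η N₂ r₂
    AvgElectricalSNRSpec P p₁ r₁ I₁ γ₁ μ₁ ∧ AvgElectricalSNRSpec P p₂ r₂ I₂ γ₂ μ₂ ∧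
    (∀ x : ℝ, 0 < x → EndToEndSNRDensityConverges p₁ p₂ r₁ r₂ μ₁ μ₂ C x) ∧
    ∃ f : ℝ → ℝ, Measurable f ∧ (∀ x, 0 ≤ f x) ∧ (∀ x, x ≤ 0 → f x = 0) ∧
      (∀ x, 0 < x → (f x : ℂ) = endToEndSNRDensity p₁ p₂ r₁ r₂ μ₁ μ₂ C x) ∧
      HasLaw γ (volume.withDensity fun x => ENNReal.ofReal (f x)) P ∧
      ∀ x, 0 < x → HasDerivAt (fun y => P.real {w | γ w ≤ y}) (f x) x :=
  theorem2_general P p₁ p₂ r₁ r₂ (by lia) (by lia) η N₁ N₂ C hη hN₁ hN₂ hC I₁ I₂ hI₁ hI₂ hI
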